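/- Let $K$ be a field; $\otimes=\otimes_K$, algebras are associative and unital, coalgebras are coassociative and counital. For coactions write $\rho(m)=m_{(0)}\otimes m_{(1)}$ (right) and $\rho(m)=m_{(-1)}\otimes m_{(0)}$ (left). **Definitions.** Let $C$ be a coalgebra. - $C$ is *coseparable* if there is a $(C,C)$-bicolinear map $\delta:C\otimes C\to C$ with $\delta\circ\Delta=\mathrm{id}_C$. - An *entwining map* for an algebra $P$ and $C$ is a linear map $\psi:C\otimes P\to P\otimes C$, $\psi(c\otimes p)=p_\alpha\otimes c^\alpha$, such that, for all $c\in C$ and $p,p'\in P$, $(pp')_\alpha\otimes c^\alpha=p_\alpha p'_\beta\otimes c^{\alpha\beta}$, $\psi(c\otimes1)=1\otimes c$, $(P\otimes\Delta)\circ\psi=(\psi\otimes C)\circ(C\otimes\psi)\circ(\Delta\otimes P)$ and $(P\otimes\varepsilon)\circ\psi=\varepsilon\otimes P$. - Let $P$ be an algebra and a right $C$-comodule with coaction $\rho^C$. The lifted canonical map is $\widetilde{\mathrm{can}}:P\otimes P\to P\otimes C$, $p\otimes p'\mapsto pp'_{(0)}\otimes p'_{(1)}$. A *colifting of the translation map*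 is a linear map $\tau:C\to P\otimes P$, written $\tau(c)=c^{[1]}\otimes c^{[2]}$, with $\widetilde{\mathrm{can}}(\tau(c))=1\otimes c$ for all $c\in C$. The algebra of coinvariants is $P^{\mathrm{co}\,C}=\{b\in P:\rho^C(bp)=b\rho^C(p)\ \forall p\in P\}$. - $P$ is a *$C$-coalgebra Galois extension* of $B=P^{\mathrm{co}\,C}$ if the canonical map $\mathrm{can}:P\otimes_BP\to P\otimes C$, $p\otimes_Bp'\mapsto pp'_{(0)}\otimes p'_{(1)}$, is an isomorphism (of left $P$-modules and right $C$-comodules). Its canonical entwining is $\psi_{\mathrm{can}}(c\otimes p)=\mathrm{can}(\mathrm{can}^{-1}(1\otimes c)\,p)$. - For a grouplike $e\in C$ (that is, $\Delta(e)=e\otimes e$, $\varepsilon(e)=1$), a $C$-coalgebra Galois extension is *$e$-copointed* if $\rho^C(p)=\psi_{\mathrm{can}}(e\otimes p)$ for all $p\in P$. An $e$-copointed $C$-coalgebra Galois extension is *principal* if $\psi_{\mathrm{can}}$ is bijective and there is a strong connection form, i.e. a linear map $\ell:C\to P\otimes P$ with $\ell(e)=1\otimes1$, $\widetilde{\mathrm{can}}(\ell(c))=1\otimes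 c$ for all $c\in C$, $(P\otimes\rho^C)\circ\ell=(\ell\otimes C)\circ\Delta$ and $(\lambda\otimes P)\circ\ell=(C\otimes\ell)\circ\Delta$, where $\lambda(p)=\psi_{\mathrm{can}}^{-1}(p\otimes e)$. **Theorem.** Assume that: 1. $H$ is a Hopf algebra over $K$ with antipode $S$, and $C$ is a coseparable coalgebra over $K$; 2. $A$ is a right $H$-comodule algebra with coaction $\rho^H:A\to A\otimes H$; 3. $P$ is a left $H$-comodule algebra with coaction ${}^H\!\rho:P\to H\otimes P$, and an $(H,C)$-bicomodule with right $C$-coaction $\rho^C:P\to P\otimes C$ (the two coactions commute); moreover there are a grouplike $e\in C$ and a bijective entwining map $\psi:C\otimes P\to P\otimes C$ such that $\rho^C(p)=\psi(e\otimes p)$ for all $p\in P$; 4. there is a colifting of the translation map $H\to A\otimes A$, $h\mapsto h^{[1]}\otimes h^{[2]}$, such that for all $h\in H$ $$h^{[1]}\otimes h^{[2]}{}_{(0)}\otimes h^{[2]}{}_{(1)}=h_{(1)}{}^{[1]}\otimes h_{(1)}{}^{[2]}\otimes h_{(2)},$$ $$h^{[1]}{}_{(1)}\otimes h^{[1]}{}_{(0)}\otimes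 h^{[2]}=S h_{(1)}\otimes h_{(2)}{}^{[1]}\otimes h_{(2)}{}^{[2]},$$ and a colifting of the translation map $C\to P\otimes P$, $c\mapsto c^{[1]}\otimes c^{[2]}$, such that for all $c\in C$ $$c^{[1]}{}_{(-1)}\otimes c^{[1]}{}_{(0)}\otimes c^{[2]}=S(c^{[2]}{}_{(-1)})\otimes c^{[1]}\otimes c^{[2]}{}_{(0)}.$$ Let $A\,\Box_H P=\{x\in A\otimes P:(\rho^H\otimes P)(x)=(A\otimes{}^H\!\rho)(x)\}$, a subalgebra of $A\otimes P$, with the right $C$-coaction induced by $a\otimes p\mapsto a\otimes\rho^C(p)$. Then $A\,\Box_H P$, with the grouplike $e$, is a principal $C$-coalgebra Galois extension of $R=(A\,\Box_H P)^{\mathrm{co}\,C}$. -/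

import Mathlib

open scoped TensorProduct

noncomputable section

namespace CotensorGalois

/-! ### Coalgebras and comodules -/

section Comodules

variable {K : Type*} [CommRing K]

/-- `C` is coseparable: the comultiplication has a `(C, C)`-bicolinear retraction
`δ : C ⊗ C → C`. -/
def IsCoseparable (K C : Type*) [CommRing K] [AddCommGroup C] [Module K C] [Coalgebra K C] :
    Prop :=
  ∃ δ : C ⊗[K] C →ₗ[K] C,
    δ ∘ₗ (Coalgebra.comul : C →ₗ[K] C ⊗[K] C) = LinearMap.id ∧
    -- left colinearity: `Δ ∘ δ = (C ⊗ δ) ∘ (Δ ⊗ C)`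
    (Coalgebra.comul : C →ₗ[K] C ⊗[K] C) ∘ₗ δ =
      δ.lTensor C ∘ₗ (TensorProduct.assoc K C C C).toLinearMap ∘ₗ
        (Coalgebra.comul : C →ₗ[K] C ⊗[K] C).rTensor C ∧
    -- right colinearity: `Δ ∘ δ = (δ ⊗ C) ∘ (C ⊗ Δ)`
    (Coalgebra.comul : C →ₗ[K] C ⊗[K] C) ∘ₗ δ =
      δ.rTensor C ∘ₗ (TensorProduct.assoc K C C C).symm.toLinearMap ∘ₗ
        (Coalgebra.comul : C →ₗ[K] C ⊗[K] C).lTensor C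

variable {C : Type*} [AddCommGroup C] [Module K C]
variable {M : Type*} [AddCommGroup M] [Module K M]

/-- `ρ : M → M ⊗ C` is a (coassociative, counital) right `C`-coaction. -/
structure IsRightCoaction [Coalgebra K C] (ρ : M →ₗ[K] M ⊗[K] C) : Prop where
  coassoc : (Coalgebra.comul : C →ₗ[K] C ⊗[K] C).lTensor M ∘ₗ ρ =
    (TensorProduct.assoc K M C C).toLinearMap ∘ₗ ρ.rTensor C ∘ₗ ρ
  counit : (TensorProduct.rid K M).toLinearMap ∘ₗ
    (Coalgebra.counit : C →ₗ[K] K).lTensor M ∘ₗ ρ = LinearMap.id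

/-- `ρ : M → C ⊗ M` is a (coassociative, counital) left `C`-coaction. -/
structure IsLeftCoaction [Coalgebra K C] (ρ : M →ₗ[K] C ⊗[K] M) : Prop where
  coassoc : ρ.lTensor C ∘ₗ ρ =
    (TensorProduct.assoc K C C M).toLinearMap ∘ₗ
      (Coalgebra.comul : C →ₗ[K] C ⊗[K] C).rTensor M ∘ₗ ρ
  counit : (TensorProduct.lid K M).toLinearMap ∘ₗ
    (Coalgebra.counit : C →ₗ[K] K).rTensor M ∘ₗ ρ = LinearMap.id

/-- The left `H`-coaction and the right `C`-coaction on `M` commute: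
`(ρH ⊗ C) ∘ ρC = (H ⊗ ρC) ∘ ρH`. -/
def CoactionsCommute {H : Type*} [AddCommGroup H] [Module K H]
    (ρH : M →ₗ[K] H ⊗[K] M) (ρC : M →ₗ[K] M ⊗[K] C) : Prop :=
  (TensorProduct.assoc K H M C).toLinearMap ∘ₗ ρH.rTensor C ∘ₗ ρC = ρC.lTensor H ∘ₗ ρH

end Comodules

/-! ### Entwining structures, canonical maps and principal extensions -/

section Extensions

variable {K : Type*} [CommRing K]
variable {C : Type*} [AddCommGroup C] [Module K C]
variable {P : Type*} [Ring P] [Algebra K P]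

/-- `ψ : C ⊗ P → P ⊗ C` is a (right-right) entwining map. -/
structure IsEntwining [Coalgebra K C] (ψ : C ⊗[K] P →ₗ[K] P ⊗[K] C) : Prop where
  /-- `ψ ∘ (C ⊗ m) = (m ⊗ C) ∘ (P ⊗ ψ) ∘ (ψ ⊗ P)` -/
  mul : ψ ∘ₗ (LinearMap.mul' K P).lTensor C =
    (LinearMap.mul' K P).rTensor C ∘ₗ (TensorProduct.assoc K P P C).symm.toLinearMap ∘ₗ
      ψ.lTensor P ∘ₗ (TensorProduct.assoc K P C P).toLinearMap ∘ₗ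
      ψ.rTensor P ∘ₗ (TensorProduct.assoc K C P P).symm.toLinearMap
  one : ∀ c : C, ψ (c ⊗ₜ 1) = 1 ⊗ₜ c
  /-- `(P ⊗ Δ) ∘ ψ = (ψ ⊗ C) ∘ (C ⊗ ψ) ∘ (Δ ⊗ P)` -/
  comul : (Coalgebra.comul : C →ₗ[K] C ⊗[K] C).lTensor P ∘ₗ ψ =
    (TensorProduct.assoc K P C C).toLinearMap ∘ₗ ψ.rTensor C ∘ₗ
      (TensorProduct.assoc K C P C).symm.toLinearMap ∘ₗ ψ.lTensor C ∘ₗ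
      (TensorProduct.assoc K C C P).toLinearMap ∘ₗ
      (Coalgebra.comul : C →ₗ[K] C ⊗[K] C).rTensor P
  /-- `(P ⊗ ε) ∘ ψ = ε ⊗ P` -/
  counit : (TensorProduct.rid K P).toLinearMap ∘ₗ
      (Coalgebra.counit : C →ₗ[K] K).lTensor P ∘ₗ ψ =
    (TensorProduct.lid K P).toLinearMap ∘ₗ (Coalgebra.counit : C →ₗ[K] K).rTensor P

/-- The lifted canonical map `P ⊗ P → P ⊗ C`, `p ⊗ p' ↦ p p'₀ ⊗ p'₁`. -/
def liftedCan (ρ : P →ₗ[K] P ⊗[K] C) : P ⊗[K] P →ₗ[K] P ⊗[K] C :=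
  (LinearMap.mul' K P).rTensor C ∘ₗ (TensorProduct.assoc K P P C).symm.toLinearMap ∘ₗ
    ρ.lTensor P

theorem liftedCan_tmul (ρ : P →ₗ[K] P ⊗[K] C) (p q : P) :
    liftedCan ρ (p ⊗ₜ q) = p • ρ q := by
  simp only [liftedCan, LinearMap.comp_apply, LinearMap.lTensor_tmul, LinearEquiv.coe_coe]
  induction ρ q using TensorProduct.induction_on with
  | zero => simp
  | tmul a c => simp [TensorProduct.smul_tmul']
  | add x y hx hy => rw [TensorProduct.tmul_add, map_add, map_add, hx, hy, smul_add]

/-- `can (r p ⊗ q) = r can (p ⊗ q)`. -/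
theorem liftedCan_leftLinear (ρ : P →ₗ[K] P ⊗[K] C) (r : P) (x : P ⊗[K] P) :
    liftedCan ρ (r • x) = r • liftedCan ρ x := by
  induction x using TensorProduct.induction_on with
  | zero => simp
  | tmul p q => rw [TensorProduct.smul_tmul', liftedCan_tmul, liftedCan_tmul, smul_eq_mul, mul_smul]
  | add x y hx hy => rw [smul_add, map_add, map_add, hx, hy, smul_add]

/-- `(can ⊗ C) ∘ (P ⊗ ρ) = (P ⊗ Δ) ∘ can`, for a coaction `ρ`. -/
theorem liftedCan_colinear [Coalgebra K C] (ρ : P →ₗ[K] P ⊗[K] C) (h : IsRightCoaction ρ) :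
    (TensorProduct.assoc K P C C).toLinearMap ∘ₗ (liftedCan ρ).rTensor C ∘ₗ
        (TensorProduct.assoc K P P C).symm.toLinearMap ∘ₗ ρ.lTensor P =
      (Coalgebra.comul : C →ₗ[K] C ⊗[K] C).lTensor P ∘ₗ liftedCan ρ := by
  have smul_left (r : P) (z : P ⊗[K] C) : (Coalgebra.comul : C →ₗ[K] C ⊗[K] C).lTensor P (r • z) =
      r • (Coalgebra.comul : C →ₗ[K] C ⊗[K] C).lTensor P z := by
    induction z using TensorProduct.induction_on with
    | zero => simp
    | tmul p c => simp [TensorProduct.smul_tmul']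
    | add x y hx hy => rw [smul_add, map_add, map_add, hx, hy, smul_add]
  have smul_assoc' (r : P) (y : P ⊗[K] C) (c : C) :
      TensorProduct.assoc K P C C ((r • y) ⊗ₜ c) =
        r • TensorProduct.assoc K P C C (y ⊗ₜ c) := by
    induction y using TensorProduct.induction_on with
    | zero => simp
    | tmul p d => simp [TensorProduct.smul_tmul']
    | add x y hx hy =>
      rw [smul_add, TensorProduct.add_tmul, TensorProduct.add_tmul, map_add, map_add, hx, hy,
        smul_add]
  ext p q
  have hq := LinearMap.congr_fun h.coassoc q
  simp only [LinearMap.comp_apply, LinearEquiv.coe_coe] at hq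
  simp only [TensorProduct.AlgebraTensorModule.curry_apply, TensorProduct.curry_apply,
    LinearMap.coe_restrictScalars, LinearMap.comp_apply, LinearMap.lTensor_tmul,
    LinearEquiv.coe_coe, liftedCan_tmul, smul_left, hq]
  induction ρ q using TensorProduct.induction_on with
  | zero => simp
  | tmul p' c => simp [liftedCan_tmul, smul_assoc']
  | add x y hx hy => simp only [TensorProduct.tmul_add, map_add, smul_add, hx, hy]

/-- A colifting of the translation map: `τ : C → P ⊗ P` with
`liftedCan (τ c) = 1 ⊗ c` for all `c`. -/
def IsColifting (ρ : P →ₗ[K] P ⊗[K] C) (τ : C →ₗ[K] P ⊗[K] P) : Prop :=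
  ∀ c : C, liftedCan ρ (τ c) = 1 ⊗ₜ c

/-- The subalgebra of coinvariants `{b | ρ (b p) = b ρ(p) for all p}`. -/
def coinvariants (ρ : P →ₗ[K] P ⊗[K] C) : Subalgebra K P where
  carrier := {b | ∀ p : P, ρ (b * p) = b • ρ p}
  mul_mem' {a b} ha hb p := by
    rw [mul_assoc, ha, hb, mul_smul]
  add_mem' {a b} ha hb p := by
    rw [add_mul, map_add, ha, hb, add_smul]
  algebraMap_mem' r p := by
    rw [← Algebra.smul_def, map_smul, algebraMap_smul]

/-- The relations `p b ⊗ p' = p ⊗ b p'`, `b ∈ B`, defining `P ⊗_B P`. -/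
def balancedRel (B : Subalgebra K P) : Submodule K (P ⊗[K] P) :=
  Submodule.span K {x | ∃ (p q : P) (b : P), b ∈ B ∧ x = (p * b) ⊗ₜ[K] q - p ⊗ₜ[K] (b * q)}

/-- The tensor product `P ⊗_B P` over a (not necessarily commutative) subalgebra `B`. -/
abbrev BalancedTensor (B : Subalgebra K P) : Type _ := (P ⊗[K] P) ⧸ balancedRel B

/-- Right multiplication `(p ⊗_B q) · r = p ⊗_B q r` on `P ⊗_B P`. -/
def BalancedTensor.mulRight (B : Subalgebra K P) (r : P) :
    BalancedTensor B →ₗ[K] BalancedTensor B :=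
  (balancedRel B).mapQ (balancedRel B) ((LinearMap.mulRight K r).lTensor P) (by
    rw [balancedRel, Submodule.span_le]
    rintro _ ⟨p, q, b, hb, rfl⟩
    refine Submodule.subset_span ⟨p, q * r, b, hb, ?_⟩
    simp [mul_assoc])

/-- Right multiplication on `P ⊗_B P` as a bilinear map. -/
def BalancedTensor.mulRightBilin (B : Subalgebra K P) :
    BalancedTensor B →ₗ[K] P →ₗ[K] BalancedTensor B :=
  LinearMap.flip
    { toFun := BalancedTensor.mulRight B
      map_add' := fun r s => by
        apply Submodule.linearMap_qext
        ext p q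
        simp [BalancedTensor.mulRight, mul_add, TensorProduct.tmul_add]
      map_smul' := fun k r => by
        apply Submodule.linearMap_qext
        ext p q
        simp [BalancedTensor.mulRight] }

/-- The canonical map `P ⊗_B P → P ⊗ C`, `p ⊗_B p' ↦ p p'₀ ⊗ p'₁`, with `B` the algebra of
coinvariants.  It is a morphism of left `P`-modules and, if `ρ` is a coaction, of right
`C`-comodules: see `liftedCan_leftLinear` and `liftedCan_colinear`. -/
def can (ρ : P →ₗ[K] P ⊗[K] C) : BalancedTensor (coinvariants ρ) →ₗ[K] P ⊗[K] C :=
  (balancedRel (coinvariants ρ)).liftQ (liftedCan ρ) (by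
    rw [balancedRel, Submodule.span_le]
    rintro _ ⟨p, q, b, hb, rfl⟩
    have hb' : ρ (b * q) = b • ρ q := hb q
    simp [liftedCan_tmul, hb', mul_smul])

/-- The translation map `c ↦ can⁻¹ (1 ⊗ c)`. -/
def translationMap (ρ : P →ₗ[K] P ⊗[K] C) (h : Function.Bijective (can ρ)) :
    C →ₗ[K] BalancedTensor (coinvariants ρ) :=
  (LinearEquiv.ofBijective (can ρ) h).symm.toLinearMap ∘ₗ TensorProduct.mk K P C 1

/-- The canonical entwining `ψ(c ⊗ p) = can (can⁻¹ (1 ⊗ c) p)`. -/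
def canonicalEntwining (ρ : P →ₗ[K] P ⊗[K] C) (h : Function.Bijective (can ρ)) :
    C ⊗[K] P →ₗ[K] P ⊗[K] C :=
  can ρ ∘ₗ TensorProduct.lift
    (BalancedTensor.mulRightBilin (coinvariants ρ) ∘ₗ translationMap ρ h)

/-- The left `C`-coaction `p ↦ ψ⁻¹ (p ⊗ e)` induced by a bijective entwining. -/
def inducedLeftCoaction (ψ : C ⊗[K] P ≃ₗ[K] P ⊗[K] C) (e : C) : P →ₗ[K] C ⊗[K] P :=
  ψ.symm.toLinearMap ∘ₗ (TensorProduct.mk K P C).flip e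

/-- `ℓ : C → P ⊗ P` is a strong connection form, with respect to the coaction `ρ`, the
grouplike element `e` and the bijective entwining `ψ`. -/
structure IsStrongConnection [Coalgebra K C] (ρ : P →ₗ[K] P ⊗[K] C) (e : C)
    (ψ : C ⊗[K] P ≃ₗ[K] P ⊗[K] C) (l : C →ₗ[K] P ⊗[K] P) : Prop where
  normalized : l e = 1 ⊗ₜ 1
  isColifting : IsColifting ρ l
  /-- `(P ⊗ ρ) ∘ ℓ = (ℓ ⊗ C) ∘ Δ` -/
  right_colinear : ρ.lTensor P ∘ₗ l =
    (TensorProduct.assoc K P P C).toLinearMap ∘ₗ l.rTensor C ∘ₗ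
      (Coalgebra.comul : C →ₗ[K] C ⊗[K] C)
  /-- `(λ ⊗ P) ∘ ℓ = (C ⊗ ℓ) ∘ Δ`, where `λ p = ψ⁻¹ (p ⊗ e)` -/
  left_colinear : (TensorProduct.assoc K C P P).toLinearMap ∘ₗ
      (inducedLeftCoaction ψ e).rTensor P ∘ₗ l =
    l.lTensor C ∘ₗ (Coalgebra.comul : C →ₗ[K] C ⊗[K] C)

/-- `P`, with the coaction `ρ` and the grouplike element `e`, is a principal `C`-extension of
its coinvariants: it is a `C`-coalgebra Galois extension (`can` is bijective) which is
`e`-copointed with respect to the canonical entwining, the canonical entwining is bijective,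
and there is a strong connection form. -/
structure IsPrincipalExtension [Coalgebra K C] (ρ : P →ₗ[K] P ⊗[K] C) (e : C) : Prop where
  isGroupLike : IsGroupLikeElem K e
  isCoaction : IsRightCoaction ρ
  galois : Function.Bijective (can ρ)
  isEntwining : IsEntwining (canonicalEntwining ρ galois)
  copointed : ∀ p : P, ρ p = canonicalEntwining ρ galois (e ⊗ₜ p)
  bijective : Function.Bijective (canonicalEntwining ρ galois)
  exists_strongConnection : ∃ l : C →ₗ[K] P ⊗[K] P,
    IsStrongConnection ρ e (LinearEquiv.ofBijective (canonicalEntwining ρ galois) bijective) l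

end Extensions

/-! ### Covariance conditions on coliftings -/

section Covariance

variable {K : Type*} [CommRing K]
variable {H : Type*} [Ring H] [HopfAlgebra K H]

/-- Right covariance: `h⁽¹⁾ ⊗ h⁽²⁾₀ ⊗ h⁽²⁾₁ = h₁⁽¹⁾ ⊗ h₁⁽²⁾ ⊗ h₂`. -/
def IsRightCovariant {A : Type*} [AddCommGroup A] [Module K A]
    (ρ : A →ₗ[K] A ⊗[K] H) (τ : H →ₗ[K] A ⊗[K] A) : Prop :=
  ρ.lTensor A ∘ₗ τ =
    (TensorProduct.assoc K A A H).toLinearMap ∘ₗ τ.rTensor H ∘ₗ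
      (Coalgebra.comul : H →ₗ[K] H ⊗[K] H)

/-- Left covariance: `h⁽¹⁾₁ ⊗ h⁽¹⁾₀ ⊗ h⁽²⁾ = S h₁ ⊗ h₂⁽¹⁾ ⊗ h₂⁽²⁾`. -/
def IsLeftCovariant {A : Type*} [AddCommGroup A] [Module K A]
    (ρ : A →ₗ[K] A ⊗[K] H) (τ : H →ₗ[K] A ⊗[K] A) : Prop :=
  (TensorProduct.assoc K H A A).toLinearMap ∘ₗ
      ((TensorProduct.comm K A H).toLinearMap ∘ₗ ρ).rTensor A ∘ₗ τ =
    TensorProduct.map (HopfAlgebra.antipode K : H →ₗ[K] H) τ ∘ₗ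
      (Coalgebra.comul : H →ₗ[K] H ⊗[K] H)

/-- Covariance with respect to a left `H`-coaction on `P`:
`c⁽¹⁾₋₁ ⊗ c⁽¹⁾₀ ⊗ c⁽²⁾ = S c⁽²⁾₋₁ ⊗ c⁽¹⁾ ⊗ c⁽²⁾₀`. -/
def IsAntipodeCovariant {P C : Type*} [AddCommGroup P] [Module K P] [AddCommGroup C] [Module K C]
    (ρ : P →ₗ[K] H ⊗[K] P) (τ : C →ₗ[K] P ⊗[K] P) : Prop :=
  (TensorProduct.assoc K H P P).toLinearMap ∘ₗ ρ.rTensor P ∘ₗ τ =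
    (TensorProduct.leftComm K P H P).toLinearMap ∘ₗ
      ((HopfAlgebra.antipode K : H →ₗ[K] H).rTensor P ∘ₗ ρ).lTensor P ∘ₗ τ

end Covariance

/-! ### The cotensor product -/

section Cotensor

variable {K : Type*} [CommRing K]
variable {H : Type*} [Ring H] [Bialgebra K H]
variable {A : Type*} [Ring A] [Algebra K A]
variable {P : Type*} [Ring P] [Algebra K P]

/-- `a ⊗ p ↦ ρA a ⊗ p`. -/
def cotensorLeft (P : Type*) [Ring P] [Algebra K P] (ρA : A →ₐ[K] A ⊗[K] H) :
    A ⊗[K] P →ₐ[K] A ⊗[K] (H ⊗[K] P) :=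
  (Algebra.TensorProduct.assoc K K K A H P).toAlgHom.comp
    (Algebra.TensorProduct.map ρA (AlgHom.id K P))

/-- `a ⊗ p ↦ a ⊗ ρP p`. -/
def cotensorRight (A : Type*) [Ring A] [Algebra K A] (ρP : P →ₐ[K] H ⊗[K] P) :
    A ⊗[K] P →ₐ[K] A ⊗[K] (H ⊗[K] P) :=
  Algebra.TensorProduct.map (AlgHom.id K A) ρP

/-- The cotensor product `A □_H P`, the equalizer of `ρA ⊗ P` and `A ⊗ ρP`, as a subalgebra
of `A ⊗ P`. -/
def cotensor (ρA : A →ₐ[K] A ⊗[K] H) (ρP : P →ₐ[K] H ⊗[K] P) : Subalgebra K (A ⊗[K] P) :=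
  AlgHom.equalizer (cotensorLeft P ρA) (cotensorRight A ρP)

variable {C : Type*} [AddCommGroup C] [Module K C]

/-- The coaction `a ⊗ p ↦ a ⊗ ρC p` restricted to `A □_H P`, with values in `(A ⊗ P) ⊗ C`. -/
def cotensorCoactionAux (ρA : A →ₐ[K] A ⊗[K] H) (ρP : P →ₐ[K] H ⊗[K] P)
    (ρC : P →ₗ[K] P ⊗[K] C) : cotensor ρA ρP →ₗ[K] (A ⊗[K] P) ⊗[K] C :=
  (TensorProduct.assoc K A P C).symm.toLinearMap ∘ₗ ρC.lTensor A ∘ₗ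
    (cotensor ρA ρP).val.toLinearMap

theorem cotensor_rTensor_injective [Module.Flat K C]
    (ρA : A →ₐ[K] A ⊗[K] H) (ρP : P →ₐ[K] H ⊗[K] P) :
    Function.Injective ((cotensor ρA ρP).val.toLinearMap.rTensor C) :=
  Module.Flat.rTensor_preserves_injective_linearMap _ Subtype.val_injective

theorem cotensorCoactionAux_mem [Module.Flat K C]
    (ρA : A →ₐ[K] A ⊗[K] H) (ρP : P →ₐ[K] H ⊗[K] P) (ρC : P →ₗ[K] P ⊗[K] C)
    (hb : CoactionsCommute ρP.toLinearMap ρC) (x : cotensor ρA ρP) :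
    cotensorCoactionAux ρA ρP ρC x ∈
      LinearMap.range ((cotensor ρA ρP).val.toLinearMap.rTensor C) := by
  have hex : Function.Exact (cotensor ρA ρP).val.toLinearMap
      ((cotensorLeft P ρA).toLinearMap - (cotensorRight A ρP).toLinearMap) := by
    intro y
    constructor
    · intro hy
      refine ⟨⟨y, ?_⟩, rfl⟩
      exact sub_eq_zero.mp hy
    · rintro ⟨z, rfl⟩
      exact sub_eq_zero.mpr z.2
  have hex' := Module.Flat.rTensor_exact C hex
  refine (hex' _).mp ?_
  rw [LinearMap.rTensor_sub]
  change (cotensorLeft P ρA).toLinearMap.rTensor C (cotensorCoactionAux ρA ρP ρC x) -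
    (cotensorRight A ρP).toLinearMap.rTensor C (cotensorCoactionAux ρA ρP ρC x) = 0
  rw [sub_eq_zero]
  -- both sides are `(A ⊗ H ⊗ ρC)` applied to the two equal images of `x`
  let T : A ⊗[K] (H ⊗[K] P) →ₗ[K] (A ⊗[K] (H ⊗[K] P)) ⊗[K] C :=
    (TensorProduct.assoc K A (H ⊗[K] P) C).symm.toLinearMap ∘ₗ
      ((TensorProduct.assoc K H P C).symm.toLinearMap ∘ₗ ρC.lTensor H).lTensor A
  have h1 : (cotensorLeft P ρA).toLinearMap.rTensor C ∘ₗ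
      (TensorProduct.assoc K A P C).symm.toLinearMap ∘ₗ ρC.lTensor A =
      T ∘ₗ (cotensorLeft P ρA).toLinearMap := by
    ext a p
    let F : (A ⊗[K] H) ⊗[K] (P ⊗[K] C) →ₗ[K] (A ⊗[K] (H ⊗[K] P)) ⊗[K] C :=
      (TensorProduct.assoc K A H P).toLinearMap.rTensor C ∘ₗ
        (TensorProduct.assoc K (A ⊗[K] H) P C).symm.toLinearMap
    have k1 (z : P ⊗[K] C) : (cotensorLeft P ρA).toLinearMap.rTensor C
        ((TensorProduct.assoc K A P C).symm (a ⊗ₜ z)) = F (ρA a ⊗ₜ z) := by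
      induction z using TensorProduct.induction_on with
      | zero => simp only [TensorProduct.tmul_zero, map_zero]
      | add y y' hy hy' => simp only [TensorProduct.tmul_add, map_add, hy, hy']
      | tmul q c => rfl
    have k2 (y : A ⊗[K] H) : T (TensorProduct.assoc K A H P (y ⊗ₜ p)) = F (y ⊗ₜ ρC p) := by
      induction y using TensorProduct.induction_on with
      | zero => simp only [TensorProduct.zero_tmul, map_zero]
      | add y y' hy hy' => simp only [TensorProduct.add_tmul, map_add, hy, hy']
      | tmul a' h =>
        simp only [F, T, LinearMap.comp_apply, LinearEquiv.coe_coe, TensorProduct.assoc_tmul,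
          LinearMap.lTensor_tmul]
        induction ρC p using TensorProduct.induction_on with
        | zero => simp only [TensorProduct.tmul_zero, map_zero]
        | add y y' hy hy' => simp only [TensorProduct.tmul_add, map_add, hy, hy']
        | tmul q c => rfl
    exact (k1 (ρC p)).trans (k2 (ρA a)).symm
  have h2 : (cotensorRight A ρP).toLinearMap.rTensor C ∘ₗ
      (TensorProduct.assoc K A P C).symm.toLinearMap ∘ₗ ρC.lTensor A =
      T ∘ₗ (cotensorRight A ρP).toLinearMap := by
    ext a p
    have key := LinearMap.congr_fun hb p
    simp only [LinearMap.comp_apply, LinearEquiv.coe_coe, AlgHom.toLinearMap_apply] at key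
    simp only [cotensorRight, T, TensorProduct.AlgebraTensorModule.curry_apply,
      TensorProduct.curry_apply, LinearMap.coe_restrictScalars, LinearMap.comp_apply,
      LinearMap.lTensor_tmul, LinearEquiv.coe_coe, AlgHom.toLinearMap_apply,
      Algebra.TensorProduct.map_tmul, AlgHom.id_apply, ← key]
    generalize ρC p = z
    induction z using TensorProduct.induction_on with
    | zero => simp
    | add y y' hy hy' => simp only [TensorProduct.tmul_add, map_add, hy, hy']
    | tmul q c => simp
  have e1 := LinearMap.congr_fun h1 (x : A ⊗[K] P)
  have e2 := LinearMap.congr_fun h2 (x : A ⊗[K] P)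
  have hx : (cotensorLeft P ρA) (x : A ⊗[K] P) = (cotensorRight A ρP) (x : A ⊗[K] P) := x.2
  exact e1.trans ((congrArg T hx).trans e2.symm)

/-- The right `C`-coaction `A □_H P → (A □_H P) ⊗ C` induced by `a ⊗ p ↦ a ⊗ ρC p`. -/
def cotensorCoaction [Module.Flat K C]
    (ρA : A →ₐ[K] A ⊗[K] H) (ρP : P →ₐ[K] H ⊗[K] P) (ρC : P →ₗ[K] P ⊗[K] C)
    (hb : CoactionsCommute ρP.toLinearMap ρC) :
    cotensor ρA ρP →ₗ[K] cotensor ρA ρP ⊗[K] C :=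
  LinearMap.codRestrictOfInjective (cotensorCoactionAux ρA ρP ρC)
    ((cotensor ρA ρP).val.toLinearMap.rTensor C) (cotensor_rTensor_injective ρA ρP)
    (cotensorCoactionAux_mem ρA ρP ρC hb)

end Cotensor

end CotensorGalois

end

open CotensorGalois

/-! Write `Q = A □_H P`. The proof has two halves. General half
(`isPrincipalExtension_of_isColifting`): let `Q` carry a bijective entwining `ψ` with `ρ(q) = ψ(e ⊗
q)` and some colifting `τ`. Coseparability of `C` gives a cointegral `γ = ε ∘ δ`, and `γ` turns a
linear map `f : C → V` into a colinear one, via `c ↦ f(c₁)₀ γ(f(c₁)₁ ⊗ c₂)` and its left-handed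
mirror. After correcting `τ` so that `τ(e) = 1 ⊗ 1`, averaging on the right and then on the left
produces a strong connection `ℓ`: the colifting property survives because `c ↦ 1 ⊗ c` and `c ↦ c ⊗
1` are already colinear, hence fixed by averaging. With `ℓ` in hand, `q ⊗ c ↦ q ℓ(c)` induces the
inverse of `can`, and `ψ` must be the canonical entwining since `can(τ(c) q) = ψ(c ⊗ q)`. Cotensor
half: both data are constructed on `A ⊗ P` and then shown to restrict to `Q`, the kernel of `D = ρ^H
⊗ P - A ⊗ ᴴρ`. The entwining is `A ⊗ ψ`; it restricts because `ψ` is `H`-colinear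
(`rTensor_comp_eq_tensorEntwining_comp`), which follows from antipode covariance of the colifting on
`P`. The colifting is `c ↦ (h^[1] ⊗ c^[1]) ⊗ (h^[2] ⊗ c^[2]₀)` with `h = c^[2]₋₁` (`cotensorLift`);
the covariance conditions say that `D` kills each of its two legs, and over a field `(ker D ⊗ V) ∩
(V ⊗ ker D) = ker D ⊗ ker D`. -/

namespace CotensorGalois

noncomputable section

/-! ### Extending linear maps on `C` to `Q`-linear maps on `Q ⊗ C`. -/

section SMulLift

variable {K Q C M : Type*} [CommRing K] [Ring Q] [Algebra K Q] [AddCommMonoid C] [Module K C]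
  [AddCommMonoid M] [Module K M] [Module Q M] [IsScalarTower K Q M]

/-- The linear map `q ⊗ c ↦ q • f c`. -/
def smulLift (f : C →ₗ[K] M) : Q ⊗[K] C →ₗ[K] M :=
  TensorProduct.lift (LinearMap.lcomp K M f ∘ₗ (Algebra.lsmul K K M).toLinearMap)

@[simp]
theorem smulLift_tmul (f : C →ₗ[K] M) (q : Q) (c : C) : smulLift f (q ⊗ₜ[K] c) = q • f c := rfl

theorem smulLift_smul (f : C →ₗ[K] M) (q : Q) (z : Q ⊗[K] C) :
    smulLift f (q • z) = q • smulLift f z := by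
  induction z using TensorProduct.induction_on with
  | zero => simp
  | tmul r c => simp [TensorProduct.smul_tmul', mul_smul]
  | add x y hx hy => simp only [smul_add, map_add, hx, hy]

theorem rTensor_mul'_assoc_symm (q : Q) (z : Q ⊗[K] C) :
    (LinearMap.mul' K Q).rTensor C ((TensorProduct.assoc K Q Q C).symm (q ⊗ₜ z)) = q • z := by
  induction z using TensorProduct.induction_on with
  | zero => simp
  | tmul r c => simp [TensorProduct.smul_tmul']
  | add x y hx hy => simp only [TensorProduct.tmul_add, smul_add, map_add, hx, hy]

end SMulLift

theorem inducedLeftCoaction_apply {K Q C : Type*} [CommRing K] [Ring Q] [Algebra K Q]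
    [AddCommGroup C] [Module K C] (ψ : C ⊗[K] Q ≃ₗ[K] Q ⊗[K] C) (e : C) (q : Q) :
    inducedLeftCoaction ψ e q = ψ.symm (q ⊗ₜ e) := rfl

/-! ### Entwinings, the canonical map and the induced left coaction. -/

section Entwining

variable {K Q C : Type*} [CommRing K] [Ring Q] [Algebra K Q] [AddCommGroup C] [Module K C]
  [Coalgebra K C]

/-- The multiplicativity axiom in the form `ψ(c ⊗ pq) = p_α ψ(c^α ⊗ q)`. The operator `r ⊗ d ↦ r ψ(d
⊗ q)` is right multiplication by `q` on `Q ⊗ C`. -/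
theorem IsEntwining.apply_tmul_mul {ψ : C ⊗[K] Q →ₗ[K] Q ⊗[K] C} (hψ : IsEntwining ψ)
    (c : C) (p q : Q) :
    ψ (c ⊗ₜ (p * q)) = smulLift (ψ ∘ₗ (TensorProduct.mk K C Q).flip q) (ψ (c ⊗ₜ p)) := by
  have h := LinearMap.congr_fun hψ.mul (c ⊗ₜ (p ⊗ₜ q))
  simp only [LinearMap.comp_apply, LinearMap.lTensor_tmul, LinearMap.mul'_apply,
    LinearEquiv.coe_coe, TensorProduct.assoc_symm_tmul, LinearMap.rTensor_tmul] at h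
  rw [h]
  induction ψ (c ⊗ₜ p) using TensorProduct.induction_on with
  | zero => simp
  | tmul r c => simp [rTensor_mul'_assoc_symm]
  | add x y hx hy => simp only [TensorProduct.add_tmul, map_add, hx, hy]

/-- The coproduct and counit axioms of `ψ`, evaluated at `e ⊗ q` with `Δ e = e ⊗ e` and `ε e = 1`,
are exactly the coaction axioms. -/
theorem IsEntwining.isRightCoaction {ψ : C ⊗[K] Q →ₗ[K] Q ⊗[K] C} (hψ : IsEntwining ψ)
    {e : C} (he : IsGroupLikeElem K e) {ρ : Q →ₗ[K] Q ⊗[K] C} (hρ : ∀ q, ρ q = ψ (e ⊗ₜ q)) :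
    IsRightCoaction ρ where
  coassoc := by
    ext q
    have h := LinearMap.congr_fun hψ.comul (e ⊗ₜ q)
    simp only [LinearMap.comp_apply, LinearEquiv.coe_coe, LinearMap.rTensor_tmul,
      he.comul_eq_tmul_self, TensorProduct.assoc_tmul, LinearMap.lTensor_tmul, ← hρ] at h ⊢
    rw [h]
    induction ρ q using TensorProduct.induction_on with
    | zero => simp
    | tmul r c => simp [hρ]
    | add x y hx hy => simp only [TensorProduct.tmul_add, map_add, hx, hy]
  counit := by
    ext q
    have h := LinearMap.congr_fun hψ.counit (e ⊗ₜ q)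
    simpa [← hρ, he.counit_eq_one] using h

theorem apply_mul_of_copointed {ψ : C ⊗[K] Q →ₗ[K] Q ⊗[K] C} (hψ : IsEntwining ψ)
    {e : C} {ρ : Q →ₗ[K] Q ⊗[K] C} (hρ : ∀ q, ρ q = ψ (e ⊗ₜ q)) (p q : Q) :
    ρ (p * q) = smulLift (ψ ∘ₗ (TensorProduct.mk K C Q).flip q) (ρ p) := by
  rw [hρ, hψ.apply_tmul_mul, ← hρ]

theorem liftedCan_mulRight {ψ : C ⊗[K] Q →ₗ[K] Q ⊗[K] C} (hψ : IsEntwining ψ)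
    {e : C} {ρ : Q →ₗ[K] Q ⊗[K] C} (hρ : ∀ q, ρ q = ψ (e ⊗ₜ q)) (x : Q ⊗[K] Q) (q : Q) :
    liftedCan ρ ((LinearMap.mulRight K q).lTensor Q x) =
      smulLift (ψ ∘ₗ (TensorProduct.mk K C Q).flip q) (liftedCan ρ x) := by
  induction x using TensorProduct.induction_on with
  | zero => simp
  | tmul r s =>
    simp [liftedCan_tmul, smulLift_smul, apply_mul_of_copointed hψ hρ]
  | add x y hx hy => simp only [map_add, hx, hy]

/-- Right `Q`-linearity of `can` turns `can(τ(c)) = 1 ⊗ c` into a formula for `ψ`. Hence any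
colifting determines the entwining; this serves both to identify it with the canonical one and to
prove its `H`-colinearity. -/
theorem IsColifting.liftedCan_mulRight {ψ : C ⊗[K] Q →ₗ[K] Q ⊗[K] C} (hψ : IsEntwining ψ)
    {e : C} {ρ : Q →ₗ[K] Q ⊗[K] C} (hρ : ∀ q, ρ q = ψ (e ⊗ₜ q)) {τ : C →ₗ[K] Q ⊗[K] Q}
    (hτ : IsColifting ρ τ) (c : C) (q : Q) :
    liftedCan ρ ((LinearMap.mulRight K q).lTensor Q (τ c)) = ψ (c ⊗ₜ q) := by
  rw [CotensorGalois.liftedCan_mulRight hψ hρ, hτ]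
  simp

theorem IsRightCoaction.mul'_eq_liftedCan {ρ : Q →ₗ[K] Q ⊗[K] C} (hρ : IsRightCoaction ρ)
    (x : Q ⊗[K] Q) :
    LinearMap.mul' K Q x =
      TensorProduct.rid K Q ((Coalgebra.counit : C →ₗ[K] K).lTensor Q (liftedCan ρ x)) := by
  have hsmul (r : Q) (z : Q ⊗[K] C) : TensorProduct.rid K Q
      ((Coalgebra.counit : C →ₗ[K] K).lTensor Q (r • z)) = r * TensorProduct.rid K Q
      ((Coalgebra.counit : C →ₗ[K] K).lTensor Q z) := by
    induction z using TensorProduct.induction_on with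
    | zero => simp
    | tmul p c => simp [TensorProduct.smul_tmul']
    | add x y hx hy => simp only [smul_add, map_add, hx, hy, mul_add]
  induction x using TensorProduct.induction_on with
  | zero => simp
  | tmul p q =>
    have h := LinearMap.congr_fun hρ.counit q
    simp only [LinearMap.comp_apply, LinearEquiv.coe_coe, LinearMap.id_apply] at h
    rw [liftedCan_tmul, hsmul, h, LinearMap.mul'_apply]
  | add x y hx hy => simp only [map_add, hx, hy]

/-- For a colifting, `c⁽¹⁾ c⁽²⁾ = ε c`. -/
theorem IsColifting.mul'_apply {ρ : Q →ₗ[K] Q ⊗[K] C} (hρ : IsRightCoaction ρ)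
    {τ : C →ₗ[K] Q ⊗[K] Q} (hτ : IsColifting ρ τ) (c : C) :
    LinearMap.mul' K Q (τ c) = algebraMap K Q (Coalgebra.counit c) := by
  rw [hρ.mul'_eq_liftedCan, hτ]
  simp [Algebra.algebraMap_eq_smul_one]

theorem inducedLeftCoaction_coassoc {ψ : C ⊗[K] Q ≃ₗ[K] Q ⊗[K] C}
    (hψ : IsEntwining ψ.toLinearMap) {e : C} (he : IsGroupLikeElem K e) :
    (inducedLeftCoaction ψ e).lTensor C ∘ₗ inducedLeftCoaction ψ e =
      (TensorProduct.assoc K C C Q).toLinearMap ∘ₗ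
        (Coalgebra.comul : C →ₗ[K] C ⊗[K] C).rTensor Q ∘ₗ inducedLeftCoaction ψ e := by
  ext q
  -- The coproduct axiom is applied to `ψ⁻¹(q ⊗ e)`. Its left side becomes `q ⊗ e ⊗ e`, and the
  -- claim follows by cancelling the two bijections `C ⊗ ψ` and `ψ ⊗ C`.
  have h := LinearMap.congr_fun hψ.comul (inducedLeftCoaction ψ e q)
  simp only [LinearMap.comp_apply, LinearEquiv.coe_coe] at h ⊢
  have h1 : ψ (inducedLeftCoaction ψ e q) = q ⊗ₜ e := ψ.apply_symm_apply _
  rw [h1, LinearMap.lTensor_tmul, he.comul_eq_tmul_self, ← LinearEquiv.symm_apply_eq,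
    TensorProduct.assoc_symm_tmul] at h
  have inj1 : Function.Injective (ψ.toLinearMap.lTensor C) :=
    (LinearEquiv.lTensor C ψ).injective
  have inj2 : Function.Injective (ψ.toLinearMap.rTensor C) :=
    (LinearEquiv.rTensor C ψ).injective
  apply inj1
  apply (TensorProduct.assoc K C Q C).symm.injective
  apply inj2
  rw [← h, ← h1]
  induction inducedLeftCoaction ψ e q using TensorProduct.induction_on with
  | zero => simp
  | tmul c p => simp [inducedLeftCoaction_apply]
  | add x y hx hy => simp only [TensorProduct.add_tmul, map_add, hx, hy]

theorem inducedLeftCoaction_one {ψ : C ⊗[K] Q ≃ₗ[K] Q ⊗[K] C}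
    (hψ : IsEntwining ψ.toLinearMap) (e : C) : inducedLeftCoaction ψ e 1 = e ⊗ₜ 1 := by
  rw [inducedLeftCoaction_apply, LinearEquiv.symm_apply_eq]
  exact (hψ.one e).symm

/-- The left canonical map is `ψ⁻¹ ∘ can`. -/
theorem symm_liftedCan_tmul {ψ : C ⊗[K] Q ≃ₗ[K] Q ⊗[K] C}
    (hψ : IsEntwining ψ.toLinearMap) {e : C} {ρ : Q →ₗ[K] Q ⊗[K] C}
    (hρ : ∀ q, ρ q = ψ (e ⊗ₜ q)) (p q : Q) :
    ψ.symm (liftedCan ρ (p ⊗ₜ q)) =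
      (LinearMap.mulRight K q).lTensor C (inducedLeftCoaction ψ e p) := by
  have key (z : C ⊗[K] Q) : ψ ((LinearMap.mulRight K q).lTensor C z) =
      smulLift (ψ.toLinearMap ∘ₗ (TensorProduct.mk K C Q).flip q) (ψ z) := by
    induction z using TensorProduct.induction_on with
    | zero => simp
    | tmul c r => exact hψ.apply_tmul_mul c r q
    | add x y hx hy => simp only [map_add, hx, hy]
  rw [LinearEquiv.symm_apply_eq, key, inducedLeftCoaction_apply, ψ.apply_symm_apply,
    liftedCan_tmul, hρ]
  rfl

end Entwining

/-! ### Contracting two copies of `C` against a bilinear form. -/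

section Contraction

variable {K C V W : Type*} [CommRing K] [AddCommGroup C] [Module K C]
  [AddCommGroup V] [Module K V] [AddCommGroup W] [Module K W]

/-- `(v ⊗ c) ⊗ d ↦ γ(c ⊗ d) v`. -/
def contractRight (V : Type*) [AddCommGroup V] [Module K V] (γ : C ⊗[K] C →ₗ[K] K) :
    (V ⊗[K] C) ⊗[K] C →ₗ[K] V :=
  (TensorProduct.rid K V).toLinearMap ∘ₗ γ.lTensor V ∘ₗ (TensorProduct.assoc K V C C).toLinearMap

/-- `c ⊗ (d ⊗ v) ↦ γ(c ⊗ d) v`. -/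
def contractLeft (V : Type*) [AddCommGroup V] [Module K V] (γ : C ⊗[K] C →ₗ[K] K) :
    C ⊗[K] (C ⊗[K] V) →ₗ[K] V :=
  (TensorProduct.lid K V).toLinearMap ∘ₗ γ.rTensor V ∘ₗ
    (TensorProduct.assoc K C C V).symm.toLinearMap

@[simp]
theorem contractRight_tmul (γ : C ⊗[K] C →ₗ[K] K) (v : V) (c d : C) :
    contractRight V γ ((v ⊗ₜ c) ⊗ₜ d) = γ (c ⊗ₜ d) • v := by
  simp [contractRight]

@[simp]
theorem contractLeft_tmul (γ : C ⊗[K] C →ₗ[K] K) (v : V) (c d : C) :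
    contractLeft V γ (c ⊗ₜ (d ⊗ₜ v)) = γ (c ⊗ₜ d) • v := by
  simp [contractLeft]

theorem comp_contractRight (γ : C ⊗[K] C →ₗ[K] K) (g : V →ₗ[K] W) :
    g ∘ₗ contractRight V γ = contractRight W γ ∘ₗ (g.rTensor C).rTensor C := by
  ext v c d
  simp

theorem comp_contractLeft (γ : C ⊗[K] C →ₗ[K] K) (g : V →ₗ[K] W) :
    g ∘ₗ contractLeft V γ = contractLeft W γ ∘ₗ (g.lTensor C).lTensor C := by
  ext c d v
  simp

end Contraction

/-! ### Cointegrals and averaging over a coseparable coalgebra. -/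

section Cointegral

variable {K C V W : Type*} [CommRing K] [AddCommGroup C] [Module K C] [Coalgebra K C]
  [AddCommGroup V] [Module K V] [AddCommGroup W] [Module K W]

/-- A cointegral on `C`: a form `γ` with `γ ∘ Δ = ε` and `c₁ γ(c₂ ⊗ d) = γ(c ⊗ d₁) d₂`. -/
structure IsCointegral (γ : C ⊗[K] C →ₗ[K] K) : Prop where
  comul (c : C) : γ (Coalgebra.comul c) = Coalgebra.counit c
  balanced (c d : C) :
    TensorProduct.rid K C (γ.lTensor C (TensorProduct.assoc K C C C (Coalgebra.comul c ⊗ₜ d))) =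
      TensorProduct.lid K C
        (γ.rTensor C ((TensorProduct.assoc K C C C).symm (c ⊗ₜ Coalgebra.comul d)))

/-- Take `γ = ε ∘ δ`. Applying `ε` to one leg of each colinearity identity for `δ` shows that `c₁
γ(c₂ ⊗ d)` and `γ(c ⊗ d₁) d₂` both equal `δ(c ⊗ d)`. -/
theorem IsCoseparable.exists_isCointegral (h : IsCoseparable K C) :
    ∃ γ : C ⊗[K] C →ₗ[K] K, IsCointegral γ := by
  obtain ⟨δ, h1, h2, h3⟩ := h
  refine ⟨Coalgebra.counit ∘ₗ δ, fun c => ?_, fun c d => ?_⟩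
  · exact congrArg Coalgebra.counit (LinearMap.congr_fun h1 c)
  · have e1 := congrArg (fun z => TensorProduct.rid K C
      ((Coalgebra.counit : C →ₗ[K] K).lTensor C z)) (LinearMap.congr_fun h2 (c ⊗ₜ d))
    have e2 := congrArg (fun z => TensorProduct.lid K C
      ((Coalgebra.counit : C →ₗ[K] K).rTensor C z)) (LinearMap.congr_fun h3 (c ⊗ₜ d))
    simp only [LinearMap.comp_apply, LinearEquiv.coe_coe, LinearMap.rTensor_tmul,
      LinearMap.lTensor_tmul, Coalgebra.lTensor_counit_comul,
      Coalgebra.rTensor_counit_comul] at e1 e2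
    rw [LinearMap.lTensor_comp, LinearMap.rTensor_comp, LinearMap.comp_apply,
      LinearMap.comp_apply, ← e1, ← e2]
    simp

/-- The balancing law with a spectator factor `V`; it will be used with `z = ρ(v)`. -/
theorem IsCointegral.contractRight_comul {γ : C ⊗[K] C →ₗ[K] K} (hγ : IsCointegral γ)
    (z : V ⊗[K] C) (d : C) :
    contractRight (V ⊗[K] C) γ ((TensorProduct.assoc K V C C).symm
        ((Coalgebra.comul : C →ₗ[K] C ⊗[K] C).lTensor V z) ⊗ₜ d) =
      (contractRight V γ).rTensor C
        ((TensorProduct.assoc K (V ⊗[K] C) C C).symm (z ⊗ₜ Coalgebra.comul d)) := by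
  induction z using TensorProduct.induction_on with
  | zero => simp
  | add x y hx hy => simp only [TensorProduct.add_tmul, map_add, hx, hy]
  | tmul v c =>
    have e1 (y : C ⊗[K] C) : contractRight (V ⊗[K] C) γ
        ((TensorProduct.assoc K V C C).symm (v ⊗ₜ y) ⊗ₜ d) =
        v ⊗ₜ TensorProduct.rid K C (γ.lTensor C (TensorProduct.assoc K C C C (y ⊗ₜ d))) := by
      induction y using TensorProduct.induction_on with
      | zero => simp
      | add x y hx hy => simp only [TensorProduct.add_tmul, TensorProduct.tmul_add, map_add, hx, hy]
      | tmul a b => simp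
    have e2 (y : C ⊗[K] C) : (contractRight V γ).rTensor C
        ((TensorProduct.assoc K (V ⊗[K] C) C C).symm ((v ⊗ₜ c) ⊗ₜ y)) =
        v ⊗ₜ TensorProduct.lid K C
          (γ.rTensor C ((TensorProduct.assoc K C C C).symm (c ⊗ₜ y))) := by
      induction y using TensorProduct.induction_on with
      | zero => simp
      | add x y hx hy => simp only [TensorProduct.tmul_add, map_add, hx, hy]
      | tmul a b => simp [TensorProduct.smul_tmul']
    rw [LinearMap.lTensor_tmul, e1, e2, hγ.balanced]

theorem IsCointegral.contractLeft_comul {γ : C ⊗[K] C →ₗ[K] K} (hγ : IsCointegral γ)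
    (z : C ⊗[K] V) (c : C) :
    contractLeft (C ⊗[K] V) γ (c ⊗ₜ TensorProduct.assoc K C C V
        ((Coalgebra.comul : C →ₗ[K] C ⊗[K] C).rTensor V z)) =
      (contractLeft V γ).lTensor C
        (TensorProduct.assoc K C C (C ⊗[K] V) (Coalgebra.comul c ⊗ₜ z)) := by
  induction z using TensorProduct.induction_on with
  | zero => simp
  | add x y hx hy => simp only [TensorProduct.tmul_add, map_add, hx, hy]
  | tmul d v =>
    have e1 (y : C ⊗[K] C) : contractLeft (C ⊗[K] V) γ
        (c ⊗ₜ TensorProduct.assoc K C C V (y ⊗ₜ v)) =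
        TensorProduct.lid K C
          (γ.rTensor C ((TensorProduct.assoc K C C C).symm (c ⊗ₜ y))) ⊗ₜ v := by
      induction y using TensorProduct.induction_on with
      | zero => simp
      | add x y hx hy => simp only [TensorProduct.add_tmul, TensorProduct.tmul_add, map_add, hx, hy]
      | tmul a b => simp [TensorProduct.smul_tmul']
    have e2 (y : C ⊗[K] C) : (contractLeft V γ).lTensor C
        (TensorProduct.assoc K C C (C ⊗[K] V) (y ⊗ₜ (d ⊗ₜ v))) =
        TensorProduct.rid K C (γ.lTensor C (TensorProduct.assoc K C C C (y ⊗ₜ d))) ⊗ₜ v := by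
      induction y using TensorProduct.induction_on with
      | zero => simp
      | add x y hx hy => simp only [TensorProduct.add_tmul, map_add, hx, hy]
      | tmul a b => simp [TensorProduct.smul_tmul']
    rw [LinearMap.rTensor_tmul, e1, e2, hγ.balanced]

/-- The average of `f` with respect to the right coaction `ρ`. -/
def averageRight (γ : C ⊗[K] C →ₗ[K] K) (ρ : V →ₗ[K] V ⊗[K] C) (f : C →ₗ[K] V) : C →ₗ[K] V :=
  contractRight V γ ∘ₗ (ρ ∘ₗ f).rTensor C ∘ₗ Coalgebra.comul

/-- The average of `f` with respect to the left coaction `ρ`. -/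
def averageLeft (γ : C ⊗[K] C →ₗ[K] K) (ρ : V →ₗ[K] C ⊗[K] V) (f : C →ₗ[K] V) : C →ₗ[K] V :=
  contractLeft V γ ∘ₗ (ρ ∘ₗ f).lTensor C ∘ₗ Coalgebra.comul

/-- Averaging is natural in the comodule. Used with `g` the canonical map, it reduces an average of
a colifting to an average of `c ↦ 1 ⊗ c`. -/
theorem comp_averageRight (γ : C ⊗[K] C →ₗ[K] K) {ρ : V →ₗ[K] V ⊗[K] C} {σ : W →ₗ[K] W ⊗[K] C}
    {g : V →ₗ[K] W} (hg : σ ∘ₗ g = g.rTensor C ∘ₗ ρ) (f : C →ₗ[K] V) :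
    g ∘ₗ averageRight γ ρ f = averageRight γ σ (g ∘ₗ f) := by
  have h : σ ∘ₗ g ∘ₗ f = g.rTensor C ∘ₗ ρ ∘ₗ f := by
    rw [← LinearMap.comp_assoc, hg, LinearMap.comp_assoc]
  rw [averageRight, averageRight, h, LinearMap.rTensor_comp C (g.rTensor C) (ρ ∘ₗ f),
    ← LinearMap.comp_assoc, comp_contractRight]
  rfl

theorem comp_averageLeft (γ : C ⊗[K] C →ₗ[K] K) {ρ : V →ₗ[K] C ⊗[K] V} {σ : W →ₗ[K] C ⊗[K] W}
    {g : V →ₗ[K] W} (hg : σ ∘ₗ g = g.lTensor C ∘ₗ ρ) (f : C →ₗ[K] V) :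
    g ∘ₗ averageLeft γ ρ f = averageLeft γ σ (g ∘ₗ f) := by
  have h : σ ∘ₗ g ∘ₗ f = g.lTensor C ∘ₗ ρ ∘ₗ f := by
    rw [← LinearMap.comp_assoc, hg, LinearMap.comp_assoc]
  rw [averageLeft, averageLeft, h, LinearMap.lTensor_comp C (g.lTensor C) (ρ ∘ₗ f),
    ← LinearMap.comp_assoc, comp_contractLeft]
  rfl

/-- For colinear `f` the average is `f(c₁) γ(c₂ ⊗ c₃) = f(c₁) ε(c₂) = f(c)`, by `γ ∘ Δ = ε`. -/
theorem IsCointegral.averageRight_eq_self {γ : C ⊗[K] C →ₗ[K] K} (hγ : IsCointegral γ)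
    {ρ : V →ₗ[K] V ⊗[K] C} {f : C →ₗ[K] V}
    (hf : ρ ∘ₗ f = f.rTensor C ∘ₗ Coalgebra.comul) : averageRight γ ρ f = f := by
  ext c
  have h1 := Coalgebra.coassoc_apply (R := K) c
  have h2 (z : C ⊗[K] C) : contractRight V γ ((f.rTensor C ∘ₗ Coalgebra.comul).rTensor C z) =
      TensorProduct.rid K V (TensorProduct.map f γ
        (TensorProduct.assoc K C C C ((Coalgebra.comul : C →ₗ[K] C ⊗[K] C).rTensor C z))) := by
    induction z using TensorProduct.induction_on with
    | zero => simp
    | add x y hx hy => simp only [map_add, hx, hy]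
    | tmul a b =>
      simp only [LinearMap.rTensor_tmul, LinearMap.comp_apply]
      induction (Coalgebra.comul a : C ⊗[K] C) using TensorProduct.induction_on with
      | zero => simp
      | add x y hx hy => simp only [TensorProduct.add_tmul, map_add, hx, hy]
      | tmul a b => simp
  have h3 (z : C ⊗[K] C) : TensorProduct.map f γ
      ((Coalgebra.comul : C →ₗ[K] C ⊗[K] C).lTensor C z) =
      f.rTensor K ((Coalgebra.counit : C →ₗ[K] K).lTensor C z) := by
    induction z using TensorProduct.induction_on with
    | zero => simp
    | add x y hx hy => simp only [map_add, hx, hy]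
    | tmul a b => simp [hγ.comul]
  rw [averageRight, hf, LinearMap.comp_apply, LinearMap.comp_apply, h2, h1, h3,
    Coalgebra.lTensor_counit_comul]
  simp

theorem IsCointegral.averageLeft_eq_self {γ : C ⊗[K] C →ₗ[K] K} (hγ : IsCointegral γ)
    {ρ : V →ₗ[K] C ⊗[K] V} {f : C →ₗ[K] V}
    (hf : ρ ∘ₗ f = f.lTensor C ∘ₗ Coalgebra.comul) : averageLeft γ ρ f = f := by
  ext c
  have h1 := Coalgebra.coassoc_symm_apply (R := K) c
  have h2 (z : C ⊗[K] C) : contractLeft V γ ((f.lTensor C ∘ₗ Coalgebra.comul).lTensor C z) =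
      TensorProduct.lid K V (TensorProduct.map γ f
        ((TensorProduct.assoc K C C C).symm
          ((Coalgebra.comul : C →ₗ[K] C ⊗[K] C).lTensor C z))) := by
    induction z using TensorProduct.induction_on with
    | zero => simp
    | add x y hx hy => simp only [map_add, hx, hy]
    | tmul a b =>
      simp only [LinearMap.lTensor_tmul, LinearMap.comp_apply]
      induction (Coalgebra.comul b : C ⊗[K] C) using TensorProduct.induction_on with
      | zero => simp
      | add x y hx hy => simp only [TensorProduct.tmul_add, map_add, hx, hy]
      | tmul a b => simp
  have h3 (z : C ⊗[K] C) : TensorProduct.map γ f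
      ((Coalgebra.comul : C →ₗ[K] C ⊗[K] C).rTensor C z) =
      f.lTensor K ((Coalgebra.counit : C →ₗ[K] K).rTensor C z) := by
    induction z using TensorProduct.induction_on with
    | zero => simp
    | add x y hx hy => simp only [map_add, hx, hy]
    | tmul a b => simp [hγ.comul]
  rw [averageLeft, hf, LinearMap.comp_apply, LinearMap.comp_apply, h2, h1, h3,
    Coalgebra.rTensor_counit_comul]
  simp

/-- Coassociativity makes the coaction of the average `f(c₁)₀ ⊗ f(c₁)₁ γ(f(c₁)₂ ⊗ c₂)`, and the
balancing law moves the free leg to the other argument: `f(c₁)₀ γ(f(c₁)₁ ⊗ c₂) ⊗ c₃`. -/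
theorem IsCointegral.averageRight_colinear {γ : C ⊗[K] C →ₗ[K] K} (hγ : IsCointegral γ)
    {ρ : V →ₗ[K] V ⊗[K] C} (hρ : (Coalgebra.comul : C →ₗ[K] C ⊗[K] C).lTensor V ∘ₗ ρ =
      (TensorProduct.assoc K V C C).toLinearMap ∘ₗ ρ.rTensor C ∘ₗ ρ) (f : C →ₗ[K] V) :
    ρ ∘ₗ averageRight γ ρ f = (averageRight γ ρ f).rTensor C ∘ₗ Coalgebra.comul := by
  have key (v : V) (d : C) : ρ (contractRight V γ (ρ v ⊗ₜ d)) =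
      (contractRight V γ).rTensor C
        ((TensorProduct.assoc K (V ⊗[K] C) C C).symm (ρ v ⊗ₜ Coalgebra.comul d)) := by
    have h := LinearMap.congr_fun hρ v
    simp only [LinearMap.comp_apply, LinearEquiv.coe_coe] at h
    rw [← hγ.contractRight_comul, h, LinearEquiv.symm_apply_apply]
    exact LinearMap.congr_fun (comp_contractRight γ ρ) (ρ v ⊗ₜ d)
  have h2 (z : C ⊗[K] C) : ρ (contractRight V γ ((ρ ∘ₗ f).rTensor C z)) =
      (contractRight V γ ∘ₗ (ρ ∘ₗ f).rTensor C).rTensor C ((TensorProduct.assoc K C C C).symm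
        ((Coalgebra.comul : C →ₗ[K] C ⊗[K] C).lTensor C z)) := by
    induction z using TensorProduct.induction_on with
    | zero => simp
    | add x y hx hy => simp only [map_add, hx, hy]
    | tmul a b =>
      rw [LinearMap.rTensor_tmul, LinearMap.comp_apply, key, LinearMap.lTensor_tmul]
      induction (Coalgebra.comul b : C ⊗[K] C) using TensorProduct.induction_on with
      | zero => simp
      | add x y hx hy => simp only [TensorProduct.tmul_add, map_add, hx, hy]
      | tmul a b => simp
  ext c
  simp only [averageRight, LinearMap.comp_apply] at h2 ⊢
  rw [h2, Coalgebra.coassoc_symm_apply, ← LinearMap.comp_apply, ← LinearMap.rTensor_comp]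
  rfl

theorem IsCointegral.averageLeft_colinear {γ : C ⊗[K] C →ₗ[K] K} (hγ : IsCointegral γ)
    {ρ : V →ₗ[K] C ⊗[K] V} (hρ : ρ.lTensor C ∘ₗ ρ = (TensorProduct.assoc K C C V).toLinearMap ∘ₗ
      (Coalgebra.comul : C →ₗ[K] C ⊗[K] C).rTensor V ∘ₗ ρ) (f : C →ₗ[K] V) :
    ρ ∘ₗ averageLeft γ ρ f = (averageLeft γ ρ f).lTensor C ∘ₗ Coalgebra.comul := by
  have key (v : V) (d : C) : ρ (contractLeft V γ (d ⊗ₜ ρ v)) =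
      (contractLeft V γ).lTensor C
        (TensorProduct.assoc K C C (C ⊗[K] V) (Coalgebra.comul d ⊗ₜ ρ v)) := by
    have h := LinearMap.congr_fun hρ v
    simp only [LinearMap.comp_apply, LinearEquiv.coe_coe] at h
    rw [← hγ.contractLeft_comul, ← h]
    exact LinearMap.congr_fun (comp_contractLeft γ ρ) (d ⊗ₜ ρ v)
  have h2 (z : C ⊗[K] C) : ρ (contractLeft V γ ((ρ ∘ₗ f).lTensor C z)) =
      (contractLeft V γ ∘ₗ (ρ ∘ₗ f).lTensor C).lTensor C (TensorProduct.assoc K C C C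
        ((Coalgebra.comul : C →ₗ[K] C ⊗[K] C).rTensor C z)) := by
    induction z using TensorProduct.induction_on with
    | zero => simp
    | add x y hx hy => simp only [map_add, hx, hy]
    | tmul a b =>
      rw [LinearMap.lTensor_tmul, LinearMap.comp_apply, key, LinearMap.rTensor_tmul]
      induction (Coalgebra.comul a : C ⊗[K] C) using TensorProduct.induction_on with
      | zero => simp
      | add x y hx hy => simp only [TensorProduct.add_tmul, map_add, hx, hy]
      | tmul a b => simp
  ext c
  simp only [averageLeft, LinearMap.comp_apply] at h2 ⊢
  rw [h2, Coalgebra.coassoc_apply, ← LinearMap.comp_apply, ← LinearMap.lTensor_comp]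
  rfl

theorem IsCointegral.apply_groupLike {γ : C ⊗[K] C →ₗ[K] K} (hγ : IsCointegral γ) {e : C}
    (he : IsGroupLikeElem K e) : γ (e ⊗ₜ e) = 1 := by
  rw [← he.comul_eq_tmul_self, hγ.comul, he.counit_eq_one]

theorem IsCointegral.averageRight_groupLike {γ : C ⊗[K] C →ₗ[K] K} (hγ : IsCointegral γ) {e : C}
    (he : IsGroupLikeElem K e) {ρ : V →ₗ[K] V ⊗[K] C} {f : C →ₗ[K] V}
    (hf : ρ (f e) = f e ⊗ₜ e) : averageRight γ ρ f e = f e := by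
  simp [averageRight, he.comul_eq_tmul_self, hf, hγ.apply_groupLike he]

theorem IsCointegral.averageLeft_groupLike {γ : C ⊗[K] C →ₗ[K] K} (hγ : IsCointegral γ) {e : C}
    (he : IsGroupLikeElem K e) {ρ : V →ₗ[K] C ⊗[K] V} {f : C →ₗ[K] V}
    (hf : ρ (f e) = e ⊗ₜ f e) : averageLeft γ ρ f e = f e := by
  simp [averageLeft, he.comul_eq_tmul_self, hf, hγ.apply_groupLike he]

/-- Averaging on the left preserves right colinearity. -/
theorem averageLeft_rightColinear (γ : C ⊗[K] C →ₗ[K] K) {ρ : V →ₗ[K] V ⊗[K] C}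
    {l : V →ₗ[K] C ⊗[K] V}
    (h : CoactionsCommute l ρ) {f : C →ₗ[K] V} (hf : ρ ∘ₗ f = f.rTensor C ∘ₗ Coalgebra.comul) :
    ρ ∘ₗ averageLeft γ l f = (averageLeft γ l f).rTensor C ∘ₗ Coalgebra.comul := by
  -- That the coactions commute says precisely that `ρ : V → V ⊗ C` is a morphism of left comodules,
  -- so naturality of the left average applies to `ρ` itself.
  rw [comp_averageLeft γ (σ := (TensorProduct.assoc K C V C).toLinearMap ∘ₗ l.rTensor C) h, hf]
  have h2 (z : C ⊗[K] C) : contractLeft (V ⊗[K] C) γ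
      ((((TensorProduct.assoc K C V C).toLinearMap ∘ₗ l.rTensor C) ∘ₗ
        f.rTensor C ∘ₗ Coalgebra.comul).lTensor C z) =
      (contractLeft V γ ∘ₗ (l ∘ₗ f).lTensor C).rTensor C ((TensorProduct.assoc K C C C).symm
        ((Coalgebra.comul : C →ₗ[K] C ⊗[K] C).lTensor C z)) := by
    induction z using TensorProduct.induction_on with
    | zero => simp
    | add x y hx hy => simp only [map_add, hx, hy]
    | tmul a b =>
      simp only [LinearMap.lTensor_tmul, LinearMap.comp_apply, LinearEquiv.coe_coe]
      induction (Coalgebra.comul b : C ⊗[K] C) using TensorProduct.induction_on with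
      | zero => simp
      | add x y hx hy => simp only [TensorProduct.tmul_add, map_add, hx, hy]
      | tmul b c =>
        simp only [LinearMap.rTensor_tmul, TensorProduct.assoc_symm_tmul, LinearMap.comp_apply,
          LinearMap.lTensor_tmul]
        induction l (f b) using TensorProduct.induction_on with
        | zero => simp
        | add x y hx hy => simp only [TensorProduct.tmul_add, TensorProduct.add_tmul, map_add,
            hx, hy]
        | tmul b d => simp [TensorProduct.smul_tmul']
  ext c
  rw [averageLeft, LinearMap.comp_apply, LinearMap.comp_apply, h2, Coalgebra.coassoc_symm_apply,
    LinearMap.comp_apply, ← LinearMap.comp_apply (LinearMap.rTensor C _),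
    ← LinearMap.rTensor_comp]
  rfl

end Cointegral

/-- The two coactions touch different legs of `Q ⊗ Q`. This is why the second averaging does not
spoil the colinearity won by the first. -/
theorem coactionsCommute_tensor {K Q C : Type*} [CommRing K] [Ring Q] [Algebra K Q]
    [AddCommGroup C] [Module K C] (l : Q →ₗ[K] C ⊗[K] Q) (ρ : Q →ₗ[K] Q ⊗[K] C) :
    CoactionsCommute ((TensorProduct.assoc K C Q Q).toLinearMap ∘ₗ l.rTensor Q)
      ((TensorProduct.assoc K Q Q C).symm.toLinearMap ∘ₗ ρ.lTensor Q) := by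
  unfold CoactionsCommute
  ext p q
  have key (w : C ⊗[K] Q) (z : Q ⊗[K] C) :
      TensorProduct.assoc K C (Q ⊗[K] Q) C ((TensorProduct.assoc K C Q Q).toLinearMap.rTensor C
        ((TensorProduct.assoc K (C ⊗[K] Q) Q C).symm (w ⊗ₜ z))) =
      (TensorProduct.assoc K Q Q C).symm.toLinearMap.lTensor C
        (TensorProduct.assoc K C Q (Q ⊗[K] C) (w ⊗ₜ z)) := by
    induction w using TensorProduct.induction_on with
    | zero => simp
    | add x y hx hy => simp only [TensorProduct.add_tmul, map_add, hx, hy]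
    | tmul c r =>
      induction z using TensorProduct.induction_on with
      | zero => simp
      | add x y hx hy => simp only [TensorProduct.tmul_add, map_add, hx, hy]
      | tmul s d => simp
  have e1 (z : Q ⊗[K] C) : ((TensorProduct.assoc K C Q Q).toLinearMap ∘ₗ l.rTensor Q).rTensor C
      ((TensorProduct.assoc K Q Q C).symm (p ⊗ₜ z)) =
      (TensorProduct.assoc K C Q Q).toLinearMap.rTensor C
        ((TensorProduct.assoc K (C ⊗[K] Q) Q C).symm (l p ⊗ₜ z)) := by
    induction z using TensorProduct.induction_on with
    | zero => simp
    | add x y hx hy => simp only [TensorProduct.tmul_add, map_add, hx, hy]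
    | tmul s d => simp
  have e2 (z : C ⊗[K] Q) :
      ((TensorProduct.assoc K Q Q C).symm.toLinearMap ∘ₗ ρ.lTensor Q).lTensor C
      (TensorProduct.assoc K C Q Q (z ⊗ₜ q)) =
      (TensorProduct.assoc K Q Q C).symm.toLinearMap.lTensor C
        (TensorProduct.assoc K C Q (Q ⊗[K] C) (z ⊗ₜ ρ q)) := by
    induction z using TensorProduct.induction_on with
    | zero => simp
    | add x y hx hy => simp only [TensorProduct.add_tmul, map_add, hx, hy]
    | tmul s d => simp
  simp [e1, e2, key]

/-! ### From a colifting to a strong connection. -/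

section StrongConnection

variable {K Q C : Type*} [CommRing K] [Ring Q] [Algebra K Q] [AddCommGroup C] [Module K C]
  [Coalgebra K C]

theorem coassoc_lTensor {ρ : Q →ₗ[K] Q ⊗[K] C} (hρ : IsRightCoaction ρ)
    (X : Type*) [AddCommGroup X] [Module K X] :
    (Coalgebra.comul : C →ₗ[K] C ⊗[K] C).lTensor (X ⊗[K] Q) ∘ₗ
        ((TensorProduct.assoc K X Q C).symm.toLinearMap ∘ₗ ρ.lTensor X) =
      (TensorProduct.assoc K (X ⊗[K] Q) C C).toLinearMap ∘ₗ
        ((TensorProduct.assoc K X Q C).symm.toLinearMap ∘ₗ ρ.lTensor X).rTensor C ∘ₗ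
        ((TensorProduct.assoc K X Q C).symm.toLinearMap ∘ₗ ρ.lTensor X) := by
  ext x q
  let F : X ⊗[K] (Q ⊗[K] (C ⊗[K] C)) →ₗ[K] (X ⊗[K] Q) ⊗[K] (C ⊗[K] C) :=
    (TensorProduct.assoc K X Q (C ⊗[K] C)).symm.toLinearMap
  have e1 (z : Q ⊗[K] C) : (Coalgebra.comul : C →ₗ[K] C ⊗[K] C).lTensor (X ⊗[K] Q)
      ((TensorProduct.assoc K X Q C).symm (x ⊗ₜ z)) =
      F (x ⊗ₜ (Coalgebra.comul : C →ₗ[K] C ⊗[K] C).lTensor Q z) := by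
    induction z using TensorProduct.induction_on with
    | zero => simp
    | add x y hx hy => simp only [TensorProduct.tmul_add, map_add, hx, hy]
    | tmul p c => simp [F]
  have e2 (z : Q ⊗[K] C) : TensorProduct.assoc K (X ⊗[K] Q) C C
      (((TensorProduct.assoc K X Q C).symm.toLinearMap ∘ₗ ρ.lTensor X).rTensor C
        ((TensorProduct.assoc K X Q C).symm (x ⊗ₜ z))) =
      F (x ⊗ₜ TensorProduct.assoc K Q C C (ρ.rTensor C z)) := by
    induction z using TensorProduct.induction_on with
    | zero => simp
    | add x y hx hy => simp only [TensorProduct.tmul_add, map_add, hx, hy]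
    | tmul p c =>
      simp only [TensorProduct.assoc_symm_tmul, LinearMap.rTensor_tmul, LinearMap.comp_apply,
        LinearMap.lTensor_tmul, LinearEquiv.coe_coe]
      induction ρ p using TensorProduct.induction_on with
      | zero => simp
      | add x y hx hy => simp only [TensorProduct.tmul_add, TensorProduct.add_tmul, map_add,
          hx, hy]
      | tmul b d => simp [F]
  have h := LinearMap.congr_fun hρ.coassoc q
  simp only [LinearMap.comp_apply, LinearEquiv.coe_coe] at h
  simpa [e1, e2] using congrArg (fun z => F (x ⊗ₜ z)) h

theorem coassoc_rTensor {l : Q →ₗ[K] C ⊗[K] Q}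
    (hl : l.lTensor C ∘ₗ l = (TensorProduct.assoc K C C Q).toLinearMap ∘ₗ
      (Coalgebra.comul : C →ₗ[K] C ⊗[K] C).rTensor Q ∘ₗ l)
    (X : Type*) [AddCommGroup X] [Module K X] :
    ((TensorProduct.assoc K C Q X).toLinearMap ∘ₗ l.rTensor X).lTensor C ∘ₗ
        ((TensorProduct.assoc K C Q X).toLinearMap ∘ₗ l.rTensor X) =
      (TensorProduct.assoc K C C (Q ⊗[K] X)).toLinearMap ∘ₗ
        (Coalgebra.comul : C →ₗ[K] C ⊗[K] C).rTensor (Q ⊗[K] X) ∘ₗ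
        ((TensorProduct.assoc K C Q X).toLinearMap ∘ₗ l.rTensor X) := by
  ext q x
  let F : (C ⊗[K] (C ⊗[K] Q)) ⊗[K] X →ₗ[K] C ⊗[K] (C ⊗[K] (Q ⊗[K] X)) :=
    (TensorProduct.assoc K C Q X).toLinearMap.lTensor C ∘ₗ
      (TensorProduct.assoc K C (C ⊗[K] Q) X).toLinearMap
  have e1 (z : C ⊗[K] Q) : TensorProduct.assoc K C C (Q ⊗[K] X)
      ((Coalgebra.comul : C →ₗ[K] C ⊗[K] C).rTensor (Q ⊗[K] X)
      (TensorProduct.assoc K C Q X (z ⊗ₜ x))) =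
      F (TensorProduct.assoc K C C Q ((Coalgebra.comul : C →ₗ[K] C ⊗[K] C).rTensor Q z) ⊗ₜ x) := by
    induction z using TensorProduct.induction_on with
    | zero => simp
    | add x y hx hy => simp only [TensorProduct.add_tmul, map_add, hx, hy]
    | tmul c p =>
      simp only [TensorProduct.assoc_tmul, LinearMap.rTensor_tmul]
      induction (Coalgebra.comul c : C ⊗[K] C) using TensorProduct.induction_on with
      | zero => simp
      | add x y hx hy => simp only [TensorProduct.add_tmul, map_add, hx, hy]
      | tmul b d => simp [F]
  have e2 (z : C ⊗[K] Q) :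
      ((TensorProduct.assoc K C Q X).toLinearMap ∘ₗ l.rTensor X).lTensor C
        (TensorProduct.assoc K C Q X (z ⊗ₜ x)) =
      F (l.lTensor C z ⊗ₜ x) := by
    induction z using TensorProduct.induction_on with
    | zero => simp
    | add x y hx hy => simp only [TensorProduct.add_tmul, map_add, hx, hy]
    | tmul c p => simp [F]
  have h := LinearMap.congr_fun hl q
  simp only [LinearMap.comp_apply, LinearEquiv.coe_coe] at h
  simpa [e1, e2] using congrArg (fun z => F (z ⊗ₜ x)) h

theorem exists_isStrongConnection {ψ : C ⊗[K] Q ≃ₗ[K] Q ⊗[K] C}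
    (hψ : IsEntwining ψ.toLinearMap) {e : C} (he : IsGroupLikeElem K e)
    {ρ : Q →ₗ[K] Q ⊗[K] C} (hρ : ∀ q, ρ q = ψ (e ⊗ₜ q))
    {γ : C ⊗[K] C →ₗ[K] K} (hγ : IsCointegral γ) {τ : C →ₗ[K] Q ⊗[K] Q} (hτ : IsColifting ρ τ) :
    ∃ l : C →ₗ[K] Q ⊗[K] Q, IsStrongConnection ρ e ψ l := by
  have hρ1 : ρ 1 = 1 ⊗ₜ e := (hρ 1).trans (hψ.one e)
  have hl1 := inducedLeftCoaction_one hψ e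
  have hcoact : IsRightCoaction ρ := hψ.isRightCoaction he hρ
  -- The correction `ε(c) (1 ⊗ 1 - τ(e))` normalizes `τ` at `e` and is invisible to `can`, since
  -- `can(1 ⊗ 1) = ρ(1) = 1 ⊗ e = can(τ(e))`.
  obtain ⟨τ', hτ', hτe⟩ : ∃ τ' : C →ₗ[K] Q ⊗[K] Q, IsColifting ρ τ' ∧ τ' e = 1 ⊗ₜ 1 := by
    refine ⟨τ + (Coalgebra.counit : C →ₗ[K] K).smulRight (1 ⊗ₜ 1 - τ e), fun c => ?_, ?_⟩
    · simp [hτ c, hτ e, liftedCan_tmul, hρ1]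
    · simp [he.counit_eq_one]
  set ρV : Q ⊗[K] Q →ₗ[K] (Q ⊗[K] Q) ⊗[K] C :=
    (TensorProduct.assoc K Q Q C).symm.toLinearMap ∘ₗ ρ.lTensor Q with hρV
  set lV : Q ⊗[K] Q →ₗ[K] C ⊗[K] (Q ⊗[K] Q) :=
    (TensorProduct.assoc K C Q Q).toLinearMap ∘ₗ (inducedLeftCoaction ψ e).rTensor Q with hlV
  set f := averageRight γ ρV τ' with hf
  have hfρ := hγ.averageRight_colinear (coassoc_lTensor hcoact Q) τ'
  have hfe : f e = 1 ⊗ₜ 1 := by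
    rw [hf, hγ.averageRight_groupLike he, hτe]
    simp [hτe, ρV, hρ1]
  -- `can` is right colinear, so `can ∘ f` is the average of `c ↦ 1 ⊗ c`, which is colinear for `Q ⊗
  -- Δ` and therefore unchanged.
  have hfτ : liftedCan ρ ∘ₗ f = TensorProduct.mk K Q C 1 := by
    have hcan : liftedCan ρ ∘ₗ τ' = TensorProduct.mk K Q C 1 := LinearMap.ext hτ'
    rw [hf, comp_averageRight γ (σ := (TensorProduct.assoc K Q C C).symm.toLinearMap ∘ₗ
      (Coalgebra.comul : C →ₗ[K] C ⊗[K] C).lTensor Q), hcan, hγ.averageRight_eq_self]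
    · ext c
      have (y : C ⊗[K] C) : (TensorProduct.assoc K Q C C).symm (1 ⊗ₜ y) =
          (TensorProduct.mk K Q C 1).rTensor C y := by
        induction y using TensorProduct.induction_on with
        | zero => simp
        | add x y hx hy => simp only [TensorProduct.tmul_add, map_add, hx, hy]
        | tmul s d => simp
      simp [this]
    · rw [LinearMap.comp_assoc, ← liftedCan_colinear ρ hcoact]
      ext : 1
      simp [ρV]
  set g := averageLeft γ lV f with hg
  have hgl := hγ.averageLeft_colinear
    (coassoc_rTensor (inducedLeftCoaction_coassoc hψ he) Q) f
  have hgρ := averageLeft_rightColinear γ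
    (coactionsCommute_tensor (inducedLeftCoaction ψ e) ρ) hfρ
  refine ⟨g, ⟨?_, ?_, ?_, ?_⟩⟩
  · rw [hg, hγ.averageLeft_groupLike he, hfe]
    simp [hfe, lV, hl1]
  -- For the left average the suitable morphism is the left canonical map `ψ⁻¹ ∘ can : Q ⊗ Q → C ⊗
  -- Q`, colinear for `Δ ⊗ Q`. It sends `f(c)` to `ψ⁻¹(1 ⊗ c) = c ⊗ 1`, again a colinear function of
  -- `c`.
  · have hcan : (ψ.symm.toLinearMap ∘ₗ liftedCan ρ) ∘ₗ f = (TensorProduct.mk K C Q).flip 1 := by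
      rw [LinearMap.comp_assoc, hfτ]
      ext c
      exact (LinearEquiv.symm_apply_eq ψ).mpr (hψ.one c).symm
    have h1 : (ψ.symm.toLinearMap ∘ₗ liftedCan ρ) ∘ₗ g = (TensorProduct.mk K C Q).flip 1 := by
      rw [hg, comp_averageLeft γ (σ := (TensorProduct.assoc K C C Q).toLinearMap ∘ₗ
        (Coalgebra.comul : C →ₗ[K] C ⊗[K] C).rTensor Q), hcan, hγ.averageLeft_eq_self]
      · ext c
        have (y : C ⊗[K] C) : (TensorProduct.assoc K C C Q) (y ⊗ₜ 1) =
            ((TensorProduct.mk K C Q).flip 1).lTensor C y := by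
          induction y using TensorProduct.induction_on with
          | zero => simp
          | add x y hx hy => simp only [TensorProduct.add_tmul, map_add, hx, hy]
          | tmul s d => simp
        simp [this]
      · ext p q
        have h := LinearMap.congr_fun (inducedLeftCoaction_coassoc hψ he) p
        simp only [LinearMap.comp_apply, LinearEquiv.coe_coe] at h
        have e1 (z : C ⊗[K] Q) : TensorProduct.assoc K C C Q
            ((Coalgebra.comul : C →ₗ[K] C ⊗[K] C).rTensor Q
              ((LinearMap.mulRight K q).lTensor C z)) =
            ((LinearMap.mulRight K q).lTensor C).lTensor C (TensorProduct.assoc K C C Q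
              ((Coalgebra.comul : C →ₗ[K] C ⊗[K] C).rTensor Q z)) := by
          induction z using TensorProduct.induction_on with
          | zero => simp
          | add x y hx hy => simp only [map_add, hx, hy]
          | tmul c r =>
            simp only [LinearMap.lTensor_tmul, LinearMap.rTensor_tmul]
            induction (Coalgebra.comul c : C ⊗[K] C) using TensorProduct.induction_on with
            | zero => simp
            | add x y hx hy => simp only [TensorProduct.add_tmul, map_add, hx, hy]
            | tmul b d => simp
        have e2 (z : C ⊗[K] Q) : (ψ.symm.toLinearMap ∘ₗ liftedCan ρ).lTensor C
            (TensorProduct.assoc K C Q Q (z ⊗ₜ q)) =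
            ((LinearMap.mulRight K q).lTensor C).lTensor C
              ((inducedLeftCoaction ψ e).lTensor C z) := by
          induction z using TensorProduct.induction_on with
          | zero => simp
          | add x y hx hy => simp only [TensorProduct.add_tmul, map_add, hx, hy]
          | tmul c r => simp [symm_liftedCan_tmul hψ hρ]
        simp [symm_liftedCan_tmul hψ hρ, e1, lV, e2, h]
    intro c
    have h2 := LinearMap.congr_fun h1 c
    simp only [LinearMap.comp_apply, LinearEquiv.coe_coe] at h2
    rw [LinearEquiv.symm_apply_eq] at h2
    exact h2.trans (hψ.one c)
  · exact LinearMap.ext fun c =>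
      (LinearEquiv.symm_apply_eq (TensorProduct.assoc K Q Q C)).mp (LinearMap.congr_fun hgρ c)
  · exact hgl

end StrongConnection

/-! ### A strong connection makes the canonical map bijective. -/

section Galois

variable {K Q C : Type*} [CommRing K] [Ring Q] [Algebra K Q] [AddCommGroup C] [Module K C]
  [Coalgebra K C]

/-- Thanks to the entwining, coinvariance need only be tested against `1`. The coinvariants thus
become the kernel of the single linear map `ρ - (· ⊗ e)`, which tensoring with a flat module
preserves. -/
theorem mem_coinvariants_iff {ψ : C ⊗[K] Q →ₗ[K] Q ⊗[K] C} (hψ : IsEntwining ψ)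
    {e : C} {ρ : Q →ₗ[K] Q ⊗[K] C} (hρ : ∀ q, ρ q = ψ (e ⊗ₜ q)) (b : Q) :
    b ∈ coinvariants ρ ↔ ρ b = b ⊗ₜ e := by
  constructor
  · intro h
    have := h 1
    rw [mul_one, hρ 1, hψ.one] at this
    simpa [TensorProduct.smul_tmul'] using this
  · intro h q
    rw [apply_mul_of_copointed hψ hρ, h, hρ q]
    rfl

/-- A strong connection splits the multiplication: `q₀ ℓ(q₁) ∈ B ⊗ Q`. -/
theorem smulLift_strongConnection_mem {ψ : C ⊗[K] Q ≃ₗ[K] Q ⊗[K] C}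
    (hψ : IsEntwining ψ.toLinearMap) {e : C} (he : IsGroupLikeElem K e)
    {ρ : Q →ₗ[K] Q ⊗[K] C} (hρ : ∀ q, ρ q = ψ (e ⊗ₜ q)) {l : C →ₗ[K] Q ⊗[K] Q}
    (hl : IsStrongConnection ρ e ψ l) [Module.Flat K Q] (q : Q) :
    smulLift l (ρ q) ∈ LinearMap.range ((coinvariants ρ).val.toLinearMap.rTensor Q) := by
  have hex : Function.Exact (coinvariants ρ).val.toLinearMap
      (ρ - (TensorProduct.mk K Q C).flip e) := by
    intro y
    simp only [LinearMap.sub_apply, sub_eq_zero, LinearMap.flip_apply, TensorProduct.mk_apply]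
    rw [← mem_coinvariants_iff hψ hρ]
    simp
  have hex' := Module.Flat.rTensor_exact Q hex
  refine (hex' _).mp ?_
  rw [LinearMap.rTensor_sub]
  change ρ.rTensor Q (smulLift l (ρ q)) -
    ((TensorProduct.mk K Q C).flip e).rTensor Q (smulLift l (ρ q)) = 0
  rw [sub_eq_zero]
  -- `F(p ⊗ c ⊗ d) = p ψ(c ⊗ ℓ(d)^[1]) ⊗ ℓ(d)^[2]`. Applying `ρ ⊗ Q` to `q₀ ℓ(q₁)` gives `F(q₀ ⊗ q₁
  -- ⊗ q₂)`; left colinearity of `ℓ` replaces the inner argument of `ψ` by `ψ⁻¹(ℓ(q₁)^[1] ⊗ e)`,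
  -- leaving `q₀ ℓ(q₁)^[1] ⊗ e ⊗ ℓ(q₁)^[2]`.
  let F : Q ⊗[K] (C ⊗[K] C) →ₗ[K] (Q ⊗[K] C) ⊗[K] Q :=
    smulLift (ψ.toLinearMap.rTensor Q ∘ₗ (TensorProduct.assoc K C Q Q).symm.toLinearMap ∘ₗ
      l.lTensor C)
  have e0 (p : Q) (x : Q ⊗[K] Q) : ρ.rTensor Q (p • x) =
      smulLift (ψ.toLinearMap.rTensor Q ∘ₗ (TensorProduct.assoc K C Q Q).symm.toLinearMap ∘ₗ
        (TensorProduct.mk K C (Q ⊗[K] Q)).flip x) (ρ p) := by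
    induction x using TensorProduct.induction_on with
    | zero =>
      simp only [smul_zero, map_zero]
      induction ρ p using TensorProduct.induction_on with
      | zero => simp
      | add x y hx hy => simp only [map_add, ← hx, ← hy, add_zero]
      | tmul r c => simp
    | add x y hx hy =>
      rw [smul_add, map_add, hx, hy]
      induction ρ p using TensorProduct.induction_on with
      | zero => simp
      | add x y hx hy =>
        rw [(smulLift _).map_add, (smulLift _).map_add, (smulLift _).map_add, ← hx, ← hy,
          add_add_add_comm]
      | tmul r c => simp
    | tmul r s =>
      rw [TensorProduct.smul_tmul', LinearMap.rTensor_tmul, smul_eq_mul,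
        apply_mul_of_copointed hψ hρ]
      induction ρ p using TensorProduct.induction_on with
      | zero => simp
      | add x y hx hy => simp only [map_add, TensorProduct.add_tmul, ← hx, ← hy]
      | tmul t c => simp [TensorProduct.smul_tmul']
  have e1 (z : Q ⊗[K] C) : ρ.rTensor Q (smulLift l z) =
      F (TensorProduct.assoc K Q C C (ρ.rTensor C z)) := by
    induction z using TensorProduct.induction_on with
    | zero => simp
    | add x y hx hy => simp only [map_add, hx, hy]
    | tmul p c =>
      rw [smulLift_tmul, e0, LinearMap.rTensor_tmul]
      induction ρ p using TensorProduct.induction_on with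
      | zero => simp
      | add x y hx hy => simp only [TensorProduct.add_tmul, map_add, hx, hy]
      | tmul t c => simp [F]
  have e2 (z : Q ⊗[K] C) : F ((Coalgebra.comul : C →ₗ[K] C ⊗[K] C).lTensor Q z) =
      ((TensorProduct.mk K Q C).flip e).rTensor Q (smulLift l z) := by
    induction z using TensorProduct.induction_on with
    | zero => simp
    | add x y hx hy => simp only [map_add, hx, hy]
    | tmul p c =>
      have h := LinearMap.congr_fun hl.left_colinear c
      simp only [LinearMap.comp_apply, LinearEquiv.coe_coe] at h
      simp only [F, LinearMap.lTensor_tmul, smulLift_tmul, LinearMap.comp_apply,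
        LinearEquiv.coe_coe, ← h, LinearEquiv.symm_apply_apply]
      induction l c using TensorProduct.induction_on with
      | zero => simp
      | add x y hx hy => simp only [smul_add, map_add, hx, hy]
      | tmul r s => simp [inducedLeftCoaction_apply, TensorProduct.smul_tmul']
  have h := LinearMap.congr_fun (hψ.isRightCoaction he hρ).coassoc q
  simp only [LinearMap.comp_apply, LinearEquiv.coe_coe] at h
  rw [e1, ← h, e2]

/-- In `Q ⊗_B Q` one has `p b ⊗ q = p ⊗ b q`: an element of `B ⊗ Q` can be multiplied out in the
right-hand leg. -/
theorem mkQ_smul_rTensor_val (B : Subalgebra K Q) (p : Q) (w : B ⊗[K] Q) :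
    (balancedRel B).mkQ (p • B.val.toLinearMap.rTensor Q w) =
      (balancedRel B).mkQ (p ⊗ₜ LinearMap.mul' K Q (B.val.toLinearMap.rTensor Q w)) := by
  induction w using TensorProduct.induction_on with
  | zero => simp
  | add x y hx hy => simp only [map_add, smul_add, TensorProduct.tmul_add, hx, hy]
  | tmul b q =>
    rw [← sub_eq_zero, ← map_sub]
    refine (Submodule.Quotient.mk_eq_zero _).mpr (Submodule.subset_span ⟨p, q, b, b.2, ?_⟩)
    simp [TensorProduct.smul_tmul']

theorem can_bijective_of_strongConnection {ψ : C ⊗[K] Q ≃ₗ[K] Q ⊗[K] C}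
    (hψ : IsEntwining ψ.toLinearMap) {e : C} (he : IsGroupLikeElem K e)
    {ρ : Q →ₗ[K] Q ⊗[K] C} (hρ : ∀ q, ρ q = ψ (e ⊗ₜ q)) {l : C →ₗ[K] Q ⊗[K] Q}
    (hl : IsStrongConnection ρ e ψ l) [Module.Flat K Q] :
    Function.Bijective (can ρ) := by
  have hcoact := hψ.isRightCoaction he hρ
  constructor
  -- `θ(can(p ⊗ q))` is the class of `p q₀ ℓ(q₁)`. Since `q₀ ℓ(q₁)` lies in `B ⊗ Q`, this equals `p
  -- ⊗ q₀ ℓ(q₁)^[1] ℓ(q₁)^[2] = p ⊗ q₀ ε(q₁) = p ⊗ q`.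
  · let θ : Q ⊗[K] C →ₗ[K] BalancedTensor (coinvariants ρ) :=
      (balancedRel (coinvariants ρ)).mkQ ∘ₗ smulLift l
    have hθ : θ ∘ₗ can ρ = LinearMap.id := by
      apply Submodule.linearMap_qext
      ext p q
      have hmul (z : Q ⊗[K] C) : LinearMap.mul' K Q (smulLift l z) = TensorProduct.rid K Q
          ((Coalgebra.counit : C →ₗ[K] K).lTensor Q z) := by
        induction z using TensorProduct.induction_on with
        | zero => simp
        | add x y hx hy => simp only [map_add, hx, hy]
        | tmul r c =>
          have h := hl.isColifting.mul'_apply hcoact c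
          have h' (x : Q ⊗[K] Q) : LinearMap.mul' K Q (r • x) = r * LinearMap.mul' K Q x := by
            induction x using TensorProduct.induction_on with
            | zero => simp
            | add x y hx hy => simp only [map_add, smul_add, mul_add, hx, hy]
            | tmul s t => simp [TensorProduct.smul_tmul', mul_assoc]
          rw [smulLift_tmul, h', h]
          simp [Algebra.algebraMap_eq_smul_one]
      obtain ⟨w, hw⟩ := smulLift_strongConnection_mem hψ he hρ hl q
      have hq := LinearMap.congr_fun hcoact.counit q
      simp only [LinearMap.comp_apply, LinearEquiv.coe_coe, LinearMap.id_apply] at hq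
      change (balancedRel (coinvariants ρ)).mkQ (smulLift l (liftedCan ρ (p ⊗ₜ q))) =
        (balancedRel (coinvariants ρ)).mkQ (p ⊗ₜ q)
      rw [liftedCan_tmul, smulLift_smul, ← hw, mkQ_smul_rTensor_val, hw, hmul, hq]
    exact Function.LeftInverse.injective (g := θ) fun x => LinearMap.congr_fun hθ x
  · intro z
    refine ⟨(balancedRel (coinvariants ρ)).mkQ (smulLift l z), ?_⟩
    change liftedCan ρ (smulLift l z) = z
    induction z using TensorProduct.induction_on with
    | zero => simp
    | add x y hx hy => simp only [map_add, hx, hy]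
    | tmul p c =>
      rw [smulLift_tmul, liftedCan_leftLinear, hl.isColifting c]
      simp [TensorProduct.smul_tmul']

/-- The class of `τ(c)` in `Q ⊗_B Q` is `can⁻¹(1 ⊗ c)`, so the defining formula of the canonical
entwining reads `can(τ(c) q) = ψ(c ⊗ q)`. -/
theorem canonicalEntwining_eq {ψ : C ⊗[K] Q →ₗ[K] Q ⊗[K] C} (hψ : IsEntwining ψ)
    {e : C} {ρ : Q →ₗ[K] Q ⊗[K] C} (hρ : ∀ q, ρ q = ψ (e ⊗ₜ q))
    {τ : C →ₗ[K] Q ⊗[K] Q} (hτ : IsColifting ρ τ) (h : Function.Bijective (can ρ)) :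
    canonicalEntwining ρ h = ψ := by
  ext c q
  have ht : translationMap ρ h c = (balancedRel (coinvariants ρ)).mkQ (τ c) := by
    simp only [translationMap, LinearMap.comp_apply, LinearEquiv.coe_coe]
    rw [LinearEquiv.symm_apply_eq]
    exact (hτ c).symm
  have h1 : canonicalEntwining ρ h (c ⊗ₜ q) =
      can ρ (BalancedTensor.mulRight (coinvariants ρ) q (translationMap ρ h c)) := rfl
  simp only [TensorProduct.AlgebraTensorModule.curry_apply, TensorProduct.curry_apply,
    LinearMap.coe_restrictScalars]
  rw [h1, ht]
  exact hτ.liftedCan_mulRight hψ hρ c q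

/-- Over a coseparable coalgebra, a copointed bijective entwining together with a colifting of
the translation map gives a principal extension. -/
theorem isPrincipalExtension_of_isColifting [Module.Flat K Q] (hC : IsCoseparable K C)
    {ψ : C ⊗[K] Q →ₗ[K] Q ⊗[K] C} (hψ : IsEntwining ψ) (hbij : Function.Bijective ψ)
    {e : C} (he : IsGroupLikeElem K e) {ρ : Q →ₗ[K] Q ⊗[K] C} (hρ : ∀ q, ρ q = ψ (e ⊗ₜ q))
    {τ : C →ₗ[K] Q ⊗[K] Q} (hτ : IsColifting ρ τ) : IsPrincipalExtension ρ e := by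
  obtain ⟨γ, hγ⟩ := hC.exists_isCointegral
  have hψ' : IsEntwining (LinearEquiv.ofBijective ψ hbij).toLinearMap := hψ
  obtain ⟨l, hl⟩ := exists_isStrongConnection hψ' he hρ hγ hτ
  have hcan := can_bijective_of_strongConnection hψ' he hρ hl
  have heq := canonicalEntwining_eq hψ hρ hτ hcan
  subst heq
  exact ⟨he, hψ.isRightCoaction he hρ, hcan, hψ, hρ, hbij, l, hl⟩

end Galois

/-! ### The map `X ⊗ ψ` and its functoriality. -/

section TensorEntwining

variable {K C M N : Type*} [CommRing K] [AddCommGroup C] [Module K C]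
  [AddCommGroup M] [Module K M] [AddCommGroup N] [Module K N]

/-- The map `c ⊗ (x ⊗ m) ↦ x ⊗ ψ(c ⊗ m)`. -/
def tensorEntwining (X : Type*) [AddCommGroup X] [Module K X] (ψ : C ⊗[K] M →ₗ[K] M ⊗[K] C) :
    C ⊗[K] (X ⊗[K] M) →ₗ[K] (X ⊗[K] M) ⊗[K] C :=
  (TensorProduct.assoc K X M C).symm.toLinearMap ∘ₗ ψ.lTensor X ∘ₗ
    (TensorProduct.leftComm K C X M).toLinearMap

variable {X : Type*} [AddCommGroup X] [Module K X]

theorem tensorEntwining_tmul (ψ : C ⊗[K] M →ₗ[K] M ⊗[K] C) (c : C) (x : X) (m : M) :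
    tensorEntwining X ψ (c ⊗ₜ (x ⊗ₜ m)) =
      (TensorProduct.assoc K X M C).symm (x ⊗ₜ ψ (c ⊗ₜ m)) := rfl

theorem tensorEntwining_bijective {ψ : C ⊗[K] M →ₗ[K] M ⊗[K] C} (hψ : Function.Bijective ψ) :
    Function.Bijective (tensorEntwining X ψ) := by
  have h : Function.Bijective (ψ.lTensor X) :=
    (LinearEquiv.lTensor X (LinearEquiv.ofBijective ψ hψ)).bijective
  exact (TensorProduct.assoc K X M C).symm.bijective.comp
    (h.comp (TensorProduct.leftComm K C X M).bijective)

theorem rTensor_lTensor_comp_tensorEntwining {ψ : C ⊗[K] M →ₗ[K] M ⊗[K] C}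
    {ψ' : C ⊗[K] N →ₗ[K] N ⊗[K] C} {g : M →ₗ[K] N}
    (h : g.rTensor C ∘ₗ ψ = ψ' ∘ₗ g.lTensor C) :
    (g.lTensor X).rTensor C ∘ₗ tensorEntwining X ψ =
      tensorEntwining X ψ' ∘ₗ (g.lTensor X).lTensor C := by
  ext c x m
  have hm := LinearMap.congr_fun h (c ⊗ₜ m)
  simp only [LinearMap.comp_apply, LinearMap.lTensor_tmul] at hm
  have e (z : M ⊗[K] C) : (g.lTensor X).rTensor C ((TensorProduct.assoc K X M C).symm (x ⊗ₜ z)) =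
      (TensorProduct.assoc K X N C).symm (x ⊗ₜ g.rTensor C z) := by
    induction z using TensorProduct.induction_on with
    | zero => simp
    | add x y hx hy => simp only [TensorProduct.tmul_add, map_add, hx, hy]
    | tmul m c => simp
  simp [tensorEntwining_tmul, e, hm]

end TensorEntwining

/-! ### Entwinings on tensor products and on kernels. -/

section Entwining

variable {K C : Type*} [CommRing K] [AddCommGroup C] [Module K C] [Coalgebra K C]
  {P : Type*} [Ring P] [Algebra K P]

theorem IsEntwining.of_apply {ψ : C ⊗[K] P →ₗ[K] P ⊗[K] C}
    (mul : ∀ (c : C) (p q : P),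
      ψ (c ⊗ₜ (p * q)) = smulLift (ψ ∘ₗ (TensorProduct.mk K C P).flip q) (ψ (c ⊗ₜ p)))
    (one : ∀ c : C, ψ (c ⊗ₜ 1) = 1 ⊗ₜ c)
    (comul : ∀ (c : C) (p : P), (Coalgebra.comul : C →ₗ[K] C ⊗[K] C).lTensor P (ψ (c ⊗ₜ p)) =
      TensorProduct.assoc K P C C (ψ.rTensor C ((TensorProduct.assoc K C P C).symm
        (ψ.lTensor C (TensorProduct.assoc K C C P (Coalgebra.comul c ⊗ₜ p))))))
    (counit : ∀ (c : C) (p : P), TensorProduct.rid K P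
      ((Coalgebra.counit : C →ₗ[K] K).lTensor P (ψ (c ⊗ₜ p))) = (Coalgebra.counit c : K) • p) :
    IsEntwining ψ where
  mul := by
    ext c p q
    simp only [TensorProduct.AlgebraTensorModule.curry_apply, TensorProduct.curry_apply,
      LinearMap.coe_restrictScalars, LinearMap.comp_apply, LinearMap.lTensor_tmul,
      LinearMap.mul'_apply, LinearEquiv.coe_coe, TensorProduct.assoc_symm_tmul,
      LinearMap.rTensor_tmul, mul]
    induction ψ (c ⊗ₜ p) using TensorProduct.induction_on with
    | zero => simp
    | tmul r c => simp [rTensor_mul'_assoc_symm]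
    | add x y hx hy => simp only [TensorProduct.add_tmul, map_add, hx, hy]
  one := one
  comul := by
    ext c p
    exact comul c p
  counit := by
    ext c p
    simpa using counit c p

/-- An entwining of `P` and `C` extends to `A ⊗ P`, for any algebra `A`. -/
theorem IsEntwining.tensorEntwining {ψ : C ⊗[K] P →ₗ[K] P ⊗[K] C} (hψ : IsEntwining ψ)
    (A : Type*) [Ring A] [Algebra K A] : IsEntwining (tensorEntwining A ψ) := by
  refine .of_apply (fun c x y => ?_) (fun c => ?_) (fun c x => ?_) (fun c x => ?_)
  · induction x using TensorProduct.induction_on with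
    | zero => simp
    | add x x' hx hx' => simp only [add_mul, TensorProduct.tmul_add, map_add, hx, hx']
    | tmul a p =>
      induction y using TensorProduct.induction_on with
      | zero =>
        simp only [mul_zero, TensorProduct.tmul_zero, map_zero]
        induction CotensorGalois.tensorEntwining A ψ (c ⊗ₜ (a ⊗ₜ p)) using
          TensorProduct.induction_on with
        | zero => simp
        | add x y hx hy => rw [map_add, ← hx, ← hy, add_zero]
        | tmul r c => simp
      | add y y' hy hy' =>
        rw [mul_add, TensorProduct.tmul_add, map_add, hy, hy']
        induction CotensorGalois.tensorEntwining A ψ (c ⊗ₜ (a ⊗ₜ p)) using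
          TensorProduct.induction_on with
        | zero => simp
        | add x y hx hy =>
          rw [(smulLift _).map_add, (smulLift _).map_add, (smulLift _).map_add, ← hx, ← hy,
            add_add_add_comm]
        | tmul r c => simp
      | tmul b q =>
        rw [Algebra.TensorProduct.tmul_mul_tmul, tensorEntwining_tmul, tensorEntwining_tmul,
          hψ.apply_tmul_mul]
        induction ψ (c ⊗ₜ p) using TensorProduct.induction_on with
        | zero => simp
        | add x y hx hy => simp only [TensorProduct.tmul_add, map_add, hx, hy]
        | tmul r d =>
          simp only [smulLift_tmul, LinearMap.comp_apply, LinearMap.flip_apply,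
            TensorProduct.mk_apply, TensorProduct.assoc_symm_tmul, tensorEntwining_tmul]
          induction ψ (d ⊗ₜ q) using TensorProduct.induction_on with
          | zero => simp
          | add x y hx hy => simp only [TensorProduct.tmul_add, smul_add, map_add, hx, hy]
          | tmul s c => simp [TensorProduct.smul_tmul']
  · rw [Algebra.TensorProduct.one_def, tensorEntwining_tmul, hψ.one]
    simp
  · induction x using TensorProduct.induction_on with
    | zero => simp
    | add x x' hx hx' => simp only [TensorProduct.tmul_add, map_add, hx, hx']
    | tmul a p =>
      have h := LinearMap.congr_fun hψ.comul (c ⊗ₜ p)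
      simp only [LinearMap.comp_apply, LinearEquiv.coe_coe, LinearMap.rTensor_tmul] at h
      have e1 (z : P ⊗[K] C) : (Coalgebra.comul : C →ₗ[K] C ⊗[K] C).lTensor (A ⊗[K] P)
          ((TensorProduct.assoc K A P C).symm (a ⊗ₜ z)) =
          (TensorProduct.assoc K A P (C ⊗[K] C)).symm
            (a ⊗ₜ (Coalgebra.comul : C →ₗ[K] C ⊗[K] C).lTensor P z) := by
        induction z using TensorProduct.induction_on with
        | zero => simp
        | add x y hx hy => simp only [TensorProduct.tmul_add, map_add, hx, hy]
        | tmul m c => simp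
      rw [tensorEntwining_tmul, e1, h]
      induction (Coalgebra.comul c : C ⊗[K] C) using TensorProduct.induction_on with
      | zero => simp
      | add x y hx hy => simp only [TensorProduct.tmul_add, TensorProduct.add_tmul, map_add, hx, hy]
      | tmul c d =>
        simp only [TensorProduct.assoc_tmul, LinearMap.lTensor_tmul, tensorEntwining_tmul]
        induction ψ (d ⊗ₜ p) using TensorProduct.induction_on with
        | zero => simp
        | add x y hx hy => simp only [TensorProduct.tmul_add, map_add, hx, hy]
        | tmul r d =>
          simp only [TensorProduct.assoc_symm_tmul, LinearMap.rTensor_tmul, tensorEntwining_tmul]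
          induction ψ (c ⊗ₜ r) using TensorProduct.induction_on with
          | zero => simp
          | add x y hx hy =>
            simp only [TensorProduct.tmul_add, TensorProduct.add_tmul, map_add, hx, hy]
          | tmul s c => simp
  · induction x using TensorProduct.induction_on with
    | zero => simp
    | add x x' hx hx' => simp only [TensorProduct.tmul_add, map_add, smul_add, hx, hx']
    | tmul a p =>
      have h := LinearMap.congr_fun hψ.counit (c ⊗ₜ p)
      simp only [LinearMap.comp_apply, LinearEquiv.coe_coe, LinearMap.rTensor_tmul,
        TensorProduct.lid_tmul] at h
      rw [tensorEntwining_tmul, ← TensorProduct.tmul_smul, ← h]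
      induction ψ (c ⊗ₜ p) using TensorProduct.induction_on with
      | zero => simp
      | add x y hx hy => simp only [TensorProduct.tmul_add, map_add, hx, hy]
      | tmul s c => simp

/-- A restriction of an entwining along an injective algebra map is an entwining. -/
theorem IsEntwining.of_injective [Module.Flat K C] {Q R : Type*} [Ring Q] [Algebra K Q] [Ring R]
    [Algebra K R] {Φ : C ⊗[K] R →ₗ[K] R ⊗[K] C} (hΦ : IsEntwining Φ) {ψ : C ⊗[K] Q →ₗ[K] Q ⊗[K] C}
    {i : Q →ₐ[K] R} (hi : Function.Injective i)
    (h : i.toLinearMap.rTensor C ∘ₗ ψ = Φ ∘ₗ i.toLinearMap.lTensor C) : IsEntwining ψ := by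
  have hi' : Function.Injective i.toLinearMap := hi
  have inj := Module.Flat.rTensor_preserves_injective_linearMap (M := C) _ hi'
  -- The coproduct axiom is an identity in `Q ⊗ (C ⊗ C)`, so it is compared with its counterpart for
  -- `R` through `i ⊗ (C ⊗ C)`.
  have inj2 := Module.Flat.rTensor_preserves_injective_linearMap (M := C ⊗[K] C) _ hi'
  have hψ (c : C) (q : Q) : i.toLinearMap.rTensor C (ψ (c ⊗ₜ q)) = Φ (c ⊗ₜ i q) :=
    LinearMap.congr_fun h (c ⊗ₜ q)
  refine .of_apply (fun c x y => ?_) (fun c => ?_) (fun c x => ?_) (fun c x => ?_)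
  · apply inj
    rw [hψ, map_mul, hΦ.apply_tmul_mul, ← hψ]
    induction ψ (c ⊗ₜ x) using TensorProduct.induction_on with
    | zero => simp
    | add x y hx hy => simp only [map_add, hx, hy]
    | tmul r d =>
      have e (z : Q ⊗[K] C) : i.toLinearMap.rTensor C (r • z) =
          i r • i.toLinearMap.rTensor C z := by
        induction z using TensorProduct.induction_on with
        | zero => simp
        | add x y hx hy => simp only [smul_add, map_add, hx, hy]
        | tmul m c => simp [TensorProduct.smul_tmul']
      simp [e, hψ]
  · apply inj
    rw [hψ, map_one, hΦ.one]
    simp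
  · apply inj2
    have h := LinearMap.congr_fun hΦ.comul (c ⊗ₜ i x)
    simp only [LinearMap.comp_apply, LinearEquiv.coe_coe, LinearMap.rTensor_tmul] at h
    have e (z : Q ⊗[K] C) : i.toLinearMap.rTensor (C ⊗[K] C)
        ((Coalgebra.comul : C →ₗ[K] C ⊗[K] C).lTensor Q z) =
        (Coalgebra.comul : C →ₗ[K] C ⊗[K] C).lTensor R (i.toLinearMap.rTensor C z) := by
      induction z using TensorProduct.induction_on with
      | zero => simp
      | add x y hx hy => simp only [map_add, hx, hy]
      | tmul m c => simp
    rw [e, hψ, h]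
    induction (Coalgebra.comul c : C ⊗[K] C) using TensorProduct.induction_on with
    | zero => simp
    | add x y hx hy => simp only [TensorProduct.add_tmul, map_add, hx, hy]
    | tmul c d =>
      simp only [TensorProduct.assoc_tmul, LinearMap.lTensor_tmul, ← hψ]
      induction ψ (d ⊗ₜ x) using TensorProduct.induction_on with
      | zero => simp
      | add x y hx hy => simp only [TensorProduct.tmul_add, map_add, hx, hy]
      | tmul r d =>
        simp only [TensorProduct.assoc_symm_tmul, LinearMap.rTensor_tmul, AlgHom.toLinearMap_apply,
          ← hψ]
        induction ψ (c ⊗ₜ r) using TensorProduct.induction_on with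
        | zero => simp
        | add x y hx hy => simp only [TensorProduct.add_tmul, map_add, hx, hy]
        | tmul s c => simp
  · apply hi
    have h := LinearMap.congr_fun hΦ.counit (c ⊗ₜ i x)
    simp only [LinearMap.comp_apply, LinearEquiv.coe_coe, LinearMap.rTensor_tmul,
      TensorProduct.lid_tmul] at h
    rw [map_smul, ← h, ← hψ]
    induction ψ (c ⊗ₜ x) using TensorProduct.induction_on with
    | zero => simp
    | add x y hx hy => simp only [map_add, hx, hy]
    | tmul s c => simp

/-- A bijection `C ⊗ R → R ⊗ C` compatible with `D : R → W` restricts to the kernel of `D`. -/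
theorem exists_bijective_restrict {C Q R W : Type*} [AddCommGroup C] [Module K C]
    [Module.Flat K C] [AddCommGroup Q] [Module K Q] [AddCommGroup R] [Module K R] [AddCommGroup W]
    [Module K W] {Φ : C ⊗[K] R →ₗ[K] R ⊗[K] C} (hΦ : Function.Bijective Φ)
    {Φ' : C ⊗[K] W →ₗ[K] W ⊗[K] C} (hΦ' : Function.Injective Φ')
    {i : Q →ₗ[K] R} (hi : Function.Injective i) {D : R →ₗ[K] W} (hex : Function.Exact i D)
    (hD : D.rTensor C ∘ₗ Φ = Φ' ∘ₗ D.lTensor C) :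
    ∃ ψ : C ⊗[K] Q →ₗ[K] Q ⊗[K] C,
      Function.Bijective ψ ∧ i.rTensor C ∘ₗ ψ = Φ ∘ₗ i.lTensor C := by
  have injr := Module.Flat.rTensor_preserves_injective_linearMap (M := C) i hi
  have injl := Module.Flat.lTensor_preserves_injective_linearMap (M := C) i hi
  have exr := Module.Flat.rTensor_exact C hex
  have exl := Module.Flat.lTensor_exact C hex
  have hD' (x : C ⊗[K] R) : D.rTensor C (Φ x) = Φ' (D.lTensor C x) := LinearMap.congr_fun hD x
  have mem (x : C ⊗[K] Q) : (Φ ∘ₗ i.lTensor C) x ∈ LinearMap.range (i.rTensor C) := by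
    refine (exr _).mp ?_
    rw [LinearMap.comp_apply, hD', exl.apply_apply_eq_zero, map_zero]
  let ψ := LinearMap.codRestrictOfInjective (Φ ∘ₗ i.lTensor C) (i.rTensor C) injr mem
  have hψ (x : C ⊗[K] Q) : i.rTensor C (ψ x) = Φ (i.lTensor C x) :=
    LinearMap.codRestrictOfInjective_comp_apply _ _ _ _ x
  refine ⟨ψ, ⟨fun x y hxy => ?_, fun y => ?_⟩, LinearMap.ext hψ⟩
  · apply injl
    apply hΦ.1
    rw [← hψ, ← hψ, hxy]
  -- The preimage `w` of `y` under `Φ` comes from `C ⊗ Q`: `Φ'` sends its image under `C ⊗ D` to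
  -- zero, and `Φ'` is injective.
  · obtain ⟨w, hw⟩ := hΦ.2 (i.rTensor C y)
    obtain ⟨x, hx⟩ := (exl w).mp (hΦ' (by rw [← hD', hw, exr.apply_apply_eq_zero, map_zero]))
    exact ⟨x, injr (by rw [hψ, hx, hw])⟩

end Entwining

/-! ### Colinearity of the entwining over `H`. -/

section Colinear

variable {K H C P : Type*} [CommRing K] [Ring H] [HopfAlgebra K H]
  [AddCommGroup C] [Module K C] [Coalgebra K C] [Ring P] [Algebra K P]

/-- The entwining is `H`-colinear if the colifting is antipode covariant. -/
theorem rTensor_comp_eq_tensorEntwining_comp {ρP : P →ₐ[K] H ⊗[K] P}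
    (hρP : IsLeftCoaction ρP.toLinearMap) {ρC : P →ₗ[K] P ⊗[K] C}
    (hPC : CoactionsCommute ρP.toLinearMap ρC) {e : C}
    {ψ : C ⊗[K] P →ₗ[K] P ⊗[K] C} (hψ : IsEntwining ψ) (hψe : ∀ p : P, ρC p = ψ (e ⊗ₜ p))
    {τ : C →ₗ[K] P ⊗[K] P} (hτ : IsColifting ρC τ)
    (hcov : IsAntipodeCovariant ρP.toLinearMap τ) :
    ρP.toLinearMap.rTensor C ∘ₗ ψ = tensorEntwining H ψ ∘ₗ ρP.toLinearMap.lTensor C := by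
  -- Start from `ψ(c ⊗ p) = c^[1] ρ^C(c^[2] p)`. Applying the `H`-coaction, and commuting it past
  -- `ρ^C`, yields `c^[1]₋₁ c^[2]₋₁ p₋₁ ⊗ c^[1]₀ ρ^C(c^[2]₀ p₀)`. Covariance turns the first factor
  -- into `S(c^[2]₋₂) c^[2]₋₁ p₋₁`, which collapses to `p₋₁`, and `p₋₁ ⊗ ψ(c ⊗ p₀)` remains.
  let E : H ⊗[K] P →ₗ[K] (H ⊗[K] P) ⊗[K] C :=
    (TensorProduct.assoc K H P C).symm.toLinearMap ∘ₗ ρC.lTensor H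
  have hE (k h : H) (r q : P) : (k ⊗ₜ[K] r : H ⊗[K] P) • E (h ⊗ₜ q) =
      (TensorProduct.assoc K H P C).symm ((k * h) ⊗ₜ (r • ρC q)) := by
    simp only [E, LinearMap.comp_apply, LinearMap.lTensor_tmul, LinearEquiv.coe_coe]
    induction ρC q using TensorProduct.induction_on with
    | zero => simp
    | add x y hx hy => simp only [TensorProduct.tmul_add, smul_add, map_add, hx, hy]
    | tmul s c => simp [TensorProduct.smul_tmul']
  have hEρ (q : P) : ρP.toLinearMap.rTensor C (ρC q) = E (ρP q) := by
    have h := LinearMap.congr_fun hPC q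
    simp only [LinearMap.comp_apply, LinearEquiv.coe_coe] at h
    exact (LinearEquiv.eq_symm_apply _).mpr h
  have hsmul (r : P) (z : P ⊗[K] C) : ρP.toLinearMap.rTensor C (r • z) =
      ρP r • ρP.toLinearMap.rTensor C z := by
    induction z using TensorProduct.induction_on with
    | zero => simp
    | add x y hx hy => simp only [smul_add, map_add, hx, hy]
    | tmul s c => simp [TensorProduct.smul_tmul']
  -- the sum over the coproduct collapses by the antipode axiom
  have key (r s : P) (y : H ⊗[K] P) :
      (smulLift (E ∘ₗ LinearMap.mulRight K y) ∘ₗ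
        ((TensorProduct.mk K H P).flip r ∘ₗ HopfAlgebra.antipode K).rTensor (H ⊗[K] P))
        (ρP.toLinearMap.lTensor H (ρP s)) =
      (TensorProduct.assoc K H P C).symm ((liftedCan ρC ∘ₗ
        (TensorProduct.mk K P P r ∘ₗ LinearMap.mulLeft K s)).lTensor H y) := by
    have hco := LinearMap.congr_fun hρP.coassoc s
    have hcu := LinearMap.congr_fun hρP.counit s
    simp only [LinearMap.comp_apply, LinearEquiv.coe_coe, AlgHom.toLinearMap_apply,
      LinearMap.id_apply] at hco hcu
    rw [hco]
    induction y using TensorProduct.induction_on with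
    | zero =>
      have : LinearMap.mulRight K (0 : H ⊗[K] P) = 0 := by
        ext
        simp
      rw [this, LinearMap.comp_zero]
      have (z : (H ⊗[K] P) ⊗[K] (H ⊗[K] P)) :
          smulLift (0 : H ⊗[K] P →ₗ[K] (H ⊗[K] P) ⊗[K] C) z = 0 := by
        induction z using TensorProduct.induction_on with
        | zero => simp
        | add x y hx hy => rw [map_add, hx, hy, add_zero]
        | tmul s c => simp
      simp [this]
    | add x y hx hy =>
      rw [map_add, map_add, ← hx, ← hy]
      simp only [LinearMap.comp_apply]
      generalize (((TensorProduct.mk K H P).flip r ∘ₗ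
        HopfAlgebra.antipode K).rTensor (H ⊗[K] P)) _ = z
      induction z using TensorProduct.induction_on with
      | zero => simp
      | add x y hx hy =>
        rw [(smulLift _).map_add, (smulLift _).map_add, (smulLift _).map_add, hx, hy,
          add_add_add_comm]
      | tmul s c => simp [mul_add]
    | tmul h p =>
      have e1 (z : H ⊗[K] P) : (smulLift (E ∘ₗ LinearMap.mulRight K (h ⊗ₜ[K] p)) ∘ₗ
          ((TensorProduct.mk K H P).flip r ∘ₗ HopfAlgebra.antipode K).rTensor (H ⊗[K] P))
          (TensorProduct.assoc K H H P ((Coalgebra.comul : H →ₗ[K] H ⊗[K] H).rTensor P z)) =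
          (TensorProduct.assoc K H P C).symm (h ⊗ₜ (r • ρC (TensorProduct.lid K P
            ((Coalgebra.counit : H →ₗ[K] K).rTensor P z) * p))) := by
        induction z using TensorProduct.induction_on with
        | zero => simp
        | add x y hx hy => simp only [map_add, add_mul, smul_add, TensorProduct.tmul_add, hx, hy]
        | tmul k q =>
          have e2 (w : H ⊗[K] H) : (smulLift (E ∘ₗ LinearMap.mulRight K (h ⊗ₜ[K] p)) ∘ₗ
              ((TensorProduct.mk K H P).flip r ∘ₗ HopfAlgebra.antipode K).rTensor (H ⊗[K] P))
              (TensorProduct.assoc K H H P (w ⊗ₜ q)) = (TensorProduct.assoc K H P C).symm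
                ((LinearMap.mul' K H ((HopfAlgebra.antipode K).rTensor H w) * h) ⊗ₜ
                  (r • ρC (q * p))) := by
            induction w using TensorProduct.induction_on with
            | zero => simp
            | add x y hx hy => simp only [map_add, add_mul, TensorProduct.add_tmul, hx, hy]
            | tmul a b => simp [hE, mul_assoc]
          rw [LinearMap.rTensor_tmul, e2, HopfAlgebra.mul_antipode_rTensor_comul_apply,
            ← Algebra.smul_def, TensorProduct.smul_tmul]
          congr 2
          simp [smul_comm r]
      rw [e1, hcu]
      simp [liftedCan_tmul]
  ext c p
  simp only [TensorProduct.AlgebraTensorModule.curry_apply, TensorProduct.curry_apply,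
    LinearMap.coe_restrictScalars, LinearMap.comp_apply, LinearMap.lTensor_tmul,
    AlgHom.toLinearMap_apply]
  have e1 (x : P ⊗[K] P) :
      ρP.toLinearMap.rTensor C (liftedCan ρC ((LinearMap.mulRight K p).lTensor P x)) =
      smulLift (E ∘ₗ LinearMap.mulRight K (ρP p) ∘ₗ ρP.toLinearMap)
        (ρP.toLinearMap.rTensor P x) := by
    induction x using TensorProduct.induction_on with
    | zero => simp
    | add x y hx hy => simp only [map_add, hx, hy]
    | tmul r s => simp [liftedCan_tmul, hsmul, hEρ]
  have e2 (x : P ⊗[K] P) : smulLift (E ∘ₗ LinearMap.mulRight K (ρP p) ∘ₗ ρP.toLinearMap)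
      ((TensorProduct.assoc K H P P).symm (TensorProduct.leftComm K P H P
        (((HopfAlgebra.antipode K).rTensor P ∘ₗ ρP.toLinearMap).lTensor P x))) =
      (TensorProduct.assoc K H P C).symm ((liftedCan ρC ∘ₗ (LinearMap.mul' K P).lTensor P ∘ₗ
        (TensorProduct.assoc K P P P).toLinearMap ∘ₗ TensorProduct.mk K (P ⊗[K] P) P x).lTensor H
          (ρP p)) := by
    induction x using TensorProduct.induction_on with
    | zero => simp
    | add x y hx hy =>
      simp only [map_add, hx, hy, LinearMap.comp_add, LinearMap.lTensor_add, LinearMap.add_apply]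
    | tmul r s =>
      have h1 : (smulLift (E ∘ₗ LinearMap.mulRight K (ρP p)) ∘ₗ
          ((TensorProduct.mk K H P).flip r ∘ₗ HopfAlgebra.antipode K).rTensor (H ⊗[K] P))
          (ρP.toLinearMap.lTensor H (ρP s)) =
          smulLift (E ∘ₗ LinearMap.mulRight K (ρP p) ∘ₗ ρP.toLinearMap)
          ((TensorProduct.assoc K H P P).symm (TensorProduct.leftComm K P H P
            (((HopfAlgebra.antipode K).rTensor P ∘ₗ ρP.toLinearMap).lTensor P (r ⊗ₜ s)))) := by
        simp only [LinearMap.lTensor_tmul, LinearMap.comp_apply, AlgHom.toLinearMap_apply]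
        generalize ρP s = z
        induction z using TensorProduct.induction_on with
        | zero => simp only [map_zero, TensorProduct.tmul_zero]
        | add x y hx hy => simp only [TensorProduct.tmul_add, map_add, hx, hy]
        | tmul h q => rfl
      rw [← h1, key]
      congr 3
  have hcovc := LinearMap.congr_fun hcov c
  simp only [LinearMap.comp_apply, LinearEquiv.coe_coe] at hcovc
  rw [← LinearEquiv.eq_symm_apply] at hcovc
  rw [← hτ.liftedCan_mulRight hψ hψe, e1, hcovc, e2]
  generalize ρP p = z
  induction z using TensorProduct.induction_on with
  | zero => simp
  | add x y hx hy => simp only [TensorProduct.tmul_add, map_add, hx, hy]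
  | tmul h q =>
    have hm (x : P ⊗[K] P) : (LinearMap.mul' K P).lTensor P (TensorProduct.assoc K P P P (x ⊗ₜ q)) =
        (LinearMap.mulRight K q).lTensor P x := by
      induction x using TensorProduct.induction_on with
      | zero => simp
      | add x y hx hy => simp only [TensorProduct.add_tmul, map_add, hx, hy]
      | tmul r s => simp
    rw [tensorEntwining_tmul, ← hτ.liftedCan_mulRight hψ hψe, LinearMap.lTensor_tmul, ← hm]
    rfl

end Colinear

/-! ### Tensor squares of kernels. -/

section Kernel

variable {K Q V W : Type*} [CommRing K] [AddCommGroup Q] [Module K Q] [AddCommGroup V] [Module K V]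
  [AddCommGroup W] [Module K W]

theorem map_injective_of_flat [Module.Flat K Q] [Module.Flat K V] {i : Q →ₗ[K] V}
    (hi : Function.Injective i) : Function.Injective (TensorProduct.map i i) := by
  rw [← LinearMap.rTensor_comp_lTensor]
  exact (Module.Flat.rTensor_preserves_injective_linearMap i hi).comp
    (Module.Flat.lTensor_preserves_injective_linearMap i hi)

/-- `(ker D ⊗ V) ∩ (V ⊗ ker D) = ker D ⊗ ker D`. -/
theorem mem_range_map_of_exact [Module.Flat K Q] [Module.Flat K V] [Module.Flat K W]
    {i : Q →ₗ[K] V} (hi : Function.Injective i) {D : V →ₗ[K] W} (hex : Function.Exact i D)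
    {t : V ⊗[K] V} (h1 : D.rTensor V t = 0) (h2 : D.lTensor V t = 0) :
    t ∈ LinearMap.range (TensorProduct.map i i) := by
  obtain ⟨s, rfl⟩ := (Module.Flat.rTensor_exact V hex t).mp h1
  -- Once `t` is lifted to `s` in `Q ⊗ V`, the other condition descends to `s`, because `i` and `D`
  -- act on different legs and `i ⊗ W` is injective.
  have h3 : i.rTensor W (D.lTensor Q s) = 0 := by
    rw [← h2, ← LinearMap.comp_apply, ← LinearMap.comp_apply, LinearMap.rTensor_comp_lTensor,
      LinearMap.lTensor_comp_rTensor]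
  have h4 : D.lTensor Q s = 0 :=
    Module.Flat.rTensor_preserves_injective_linearMap (M := W) i hi (h3.trans (map_zero _).symm)
  obtain ⟨r, rfl⟩ := (Module.Flat.lTensor_exact Q hex s).mp h4
  exact ⟨r, by rw [← LinearMap.rTensor_comp_lTensor]; rfl⟩

end Kernel

theorem rTensor_sub_comp {K C V W : Type*} [CommRing K] [AddCommGroup C] [Module K C]
    [AddCommGroup V] [Module K V] [AddCommGroup W] [Module K W] {Φ : C ⊗[K] V →ₗ[K] V ⊗[K] C}
    {Φ' : C ⊗[K] W →ₗ[K] W ⊗[K] C} {D D' : V →ₗ[K] W}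
    (h : D.rTensor C ∘ₗ Φ = Φ' ∘ₗ D.lTensor C) (h' : D'.rTensor C ∘ₗ Φ = Φ' ∘ₗ D'.lTensor C) :
    (D - D').rTensor C ∘ₗ Φ = Φ' ∘ₗ (D - D').lTensor C := by
  rw [LinearMap.rTensor_sub, LinearMap.lTensor_sub]
  exact LinearMap.ext fun x => (congrArg₂ (· - ·) (LinearMap.congr_fun h x)
    (LinearMap.congr_fun h' x)).trans (map_sub Φ' _ _).symm

/-! ### The entwining and the colifting on the cotensor product. -/

section Cotensor

variable {K H C A P : Type*} [CommRing K] [Ring H] [HopfAlgebra K H]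
  [AddCommGroup C] [Module K C] [Ring A] [Algebra K A] [Ring P] [Algebra K P]

theorem cotensor_exact (ρA : A →ₐ[K] A ⊗[K] H) (ρP : P →ₐ[K] H ⊗[K] P) :
    Function.Exact (cotensor ρA ρP).val.toLinearMap
      ((cotensorLeft P ρA).toLinearMap - (cotensorRight A ρP).toLinearMap) := by
  intro y
  constructor
  · intro hy
    exact ⟨⟨y, sub_eq_zero.mp hy⟩, rfl⟩
  · rintro ⟨z, rfl⟩
    exact sub_eq_zero.mpr z.2

/-- This half of the compatibility is automatic: `ρA` acts on `A` while `ψ` acts on `P`. Only the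
other map of the equalizer needs `ψ` to be `H`-colinear. -/
theorem rTensor_cotensorLeft_comp_tensorEntwining (ρA : A →ₐ[K] A ⊗[K] H)
    (ψ : C ⊗[K] P →ₗ[K] P ⊗[K] C) :
    (cotensorLeft P ρA).toLinearMap.rTensor C ∘ₗ tensorEntwining A ψ =
      tensorEntwining A (tensorEntwining H ψ) ∘ₗ (cotensorLeft P ρA).toLinearMap.lTensor C := by
  ext c a p
  have h1 (z : P ⊗[K] C) : (cotensorLeft P ρA).toLinearMap.rTensor C
      ((TensorProduct.assoc K A P C).symm (a ⊗ₜ z)) =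
      (TensorProduct.assoc K A H P).toLinearMap.rTensor C
        ((TensorProduct.assoc K (A ⊗[K] H) P C).symm (ρA a ⊗ₜ z)) := by
    induction z using TensorProduct.induction_on with
    | zero => simp
    | add x y hx hy => simp only [TensorProduct.tmul_add, map_add, hx, hy]
    | tmul q d => rfl
  have h2 (y : A ⊗[K] H) : tensorEntwining A (tensorEntwining H ψ)
      (c ⊗ₜ TensorProduct.assoc K A H P (y ⊗ₜ p)) =
      (TensorProduct.assoc K A H P).toLinearMap.rTensor C
        ((TensorProduct.assoc K (A ⊗[K] H) P C).symm (y ⊗ₜ ψ (c ⊗ₜ p))) := by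
    induction y using TensorProduct.induction_on with
    | zero => simp
    | add x y hx hy => simp only [TensorProduct.tmul_add, TensorProduct.add_tmul, map_add, hx, hy]
    | tmul b h =>
      rw [TensorProduct.assoc_tmul, tensorEntwining_tmul, tensorEntwining_tmul]
      induction ψ (c ⊗ₜ p) using TensorProduct.induction_on with
      | zero => simp
      | add x y hx hy => simp only [TensorProduct.tmul_add, map_add, hx, hy]
      | tmul q d => simp
  exact (h1 _).trans (h2 _).symm

theorem rTensor_cotensorCoaction [Module.Flat K C] (ρA : A →ₐ[K] A ⊗[K] H)
    (ρP : P →ₐ[K] H ⊗[K] P) (ρC : P →ₗ[K] P ⊗[K] C) (hPC : CoactionsCommute ρP.toLinearMap ρC)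
    (x : cotensor ρA ρP) :
    (cotensor ρA ρP).val.toLinearMap.rTensor C (cotensorCoaction ρA ρP ρC hPC x) =
      (TensorProduct.assoc K A P C).symm (ρC.lTensor A x) :=
  LinearMap.codRestrictOfInjective_comp_apply _ _ _ _ x

/-- The entwining of `A □_H P`, the restriction of `A ⊗ ψ`. -/
theorem exists_entwining_cotensor [Coalgebra K C] [Module.Flat K C] (ρA : A →ₐ[K] A ⊗[K] H)
    (ρP : P →ₐ[K] H ⊗[K] P) (ρC : P →ₗ[K] P ⊗[K] C) (hPC : CoactionsCommute ρP.toLinearMap ρC)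
    {e : C} {ψ : C ⊗[K] P →ₗ[K] P ⊗[K] C} (hψ : IsEntwining ψ) (hbij : Function.Bijective ψ)
    (hψe : ∀ p : P, ρC p = ψ (e ⊗ₜ p))
    (hcol : ρP.toLinearMap.rTensor C ∘ₗ ψ =
      tensorEntwining H ψ ∘ₗ ρP.toLinearMap.lTensor C) :
    ∃ φ : C ⊗[K] cotensor ρA ρP →ₗ[K] cotensor ρA ρP ⊗[K] C, IsEntwining φ ∧
      Function.Bijective φ ∧ ∀ x, cotensorCoaction ρA ρP ρC hPC x = φ (e ⊗ₜ x) := by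
  have hi : Function.Injective (cotensor ρA ρP).val := Subtype.val_injective
  have hr : (cotensorRight A ρP).toLinearMap.rTensor C ∘ₗ tensorEntwining A ψ =
      tensorEntwining A (tensorEntwining H ψ) ∘ₗ (cotensorRight A ρP).toLinearMap.lTensor C :=
    rTensor_lTensor_comp_tensorEntwining hcol
  obtain ⟨φ, hφ, hφi⟩ := exists_bijective_restrict (tensorEntwining_bijective (X := A) hbij)
    (tensorEntwining_bijective (X := A) (tensorEntwining_bijective (X := H) hbij)).1
    (i := (cotensor ρA ρP).val.toLinearMap) hi (cotensor_exact ρA ρP)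
    (rTensor_sub_comp (rTensor_cotensorLeft_comp_tensorEntwining ρA ψ) hr)
  refine ⟨φ, (hψ.tensorEntwining A).of_injective hi hφi, hφ, fun x => ?_⟩
  apply cotensor_rTensor_injective ρA ρP
  rw [rTensor_cotensorCoaction]
  refine Eq.trans ?_ (LinearMap.congr_fun hφi (e ⊗ₜ x)).symm
  have h : (TensorProduct.assoc K A P C).symm.toLinearMap ∘ₗ ρC.lTensor A =
      tensorEntwining A ψ ∘ₗ TensorProduct.mk K C (A ⊗[K] P) e := by
    ext a p
    simp [tensorEntwining_tmul, hψe]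
  exact LinearMap.congr_fun h x

/-- The map `p ⊗ q ↦ (q₋₁⁽¹⁾ ⊗ p) ⊗ (q₋₁⁽²⁾ ⊗ q₀)`. -/
def cotensorLift (τ : H →ₗ[K] A ⊗[K] A) (ρP : P →ₗ[K] H ⊗[K] P) :
    P ⊗[K] P →ₗ[K] (A ⊗[K] P) ⊗[K] (A ⊗[K] P) :=
  (TensorProduct.tensorTensorTensorComm K A A P P).toLinearMap ∘ₗ τ.rTensor (P ⊗[K] P) ∘ₗ
    (TensorProduct.leftComm K P H P).toLinearMap ∘ₗ ρP.lTensor P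

/-- The second leg lies in the cotensor product for every `p ⊗ q`: right covariance and
coassociativity turn both sides into `(q₋₂^[1] ⊗ p) ⊗ (q₋₂^[2] ⊗ q₋₁ ⊗ q₀)`. -/
theorem lTensor_cotensorLift {ρA : A →ₐ[K] A ⊗[K] H} {ρP : P →ₐ[K] H ⊗[K] P}
    (hρP : IsLeftCoaction ρP.toLinearMap) {τ : H →ₗ[K] A ⊗[K] A}
    (hτ : IsRightCovariant ρA.toLinearMap τ) (x : P ⊗[K] P) :
    (cotensorLeft P ρA).toLinearMap.lTensor (A ⊗[K] P) (cotensorLift τ ρP.toLinearMap x) =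
      (cotensorRight A ρP).toLinearMap.lTensor (A ⊗[K] P)
        (cotensorLift τ ρP.toLinearMap x) := by
  induction x using TensorProduct.induction_on with
  | zero => simp
  | add x y hx hy => simp only [map_add, hx, hy]
  | tmul p q =>
    let M : (A ⊗[K] A) ⊗[K] (H ⊗[K] P) →ₗ[K] (A ⊗[K] P) ⊗[K] (A ⊗[K] (H ⊗[K] P)) :=
      ((TensorProduct.mk K A P).flip p).rTensor _ ∘ₗ
        (TensorProduct.assoc K A A (H ⊗[K] P)).toLinearMap
    let N (s : P) : A ⊗[K] (A ⊗[K] H) →ₗ[K] (A ⊗[K] P) ⊗[K] (A ⊗[K] (H ⊗[K] P)) :=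
      TensorProduct.map ((TensorProduct.mk K A P).flip p)
        ((TensorProduct.assoc K A H P).toLinearMap ∘ₗ (TensorProduct.mk K (A ⊗[K] H) P).flip s)
    have f1 (y : A ⊗[K] A) (s : P) : (cotensorLeft P ρA).toLinearMap.lTensor (A ⊗[K] P)
        (TensorProduct.tensorTensorTensorComm K A A P P (y ⊗ₜ (p ⊗ₜ s))) =
        N s (ρA.toLinearMap.lTensor A y) := by
      induction y using TensorProduct.induction_on with
      | zero => simp
      | add x y hx hy => simp only [TensorProduct.add_tmul, map_add, hx, hy]
      | tmul a b => rfl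
    have f2 (w : H ⊗[K] H) (s : P) :
        N s (TensorProduct.assoc K A A H (τ.rTensor H w)) =
        M (τ.rTensor _ (TensorProduct.assoc K H H P (w ⊗ₜ s))) := by
      induction w using TensorProduct.induction_on with
      | zero => simp
      | add x y hx hy => simp only [TensorProduct.add_tmul, map_add, hx, hy]
      | tmul h k =>
        simp only [LinearMap.rTensor_tmul, TensorProduct.assoc_tmul]
        induction τ h using TensorProduct.induction_on with
        | zero => simp
        | add x y hx hy => simp only [TensorProduct.add_tmul, map_add, hx, hy]
        | tmul a b => simp [M, N]
    have f3 (y : A ⊗[K] A) (s : P) : (cotensorRight A ρP).toLinearMap.lTensor (A ⊗[K] P)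
        (TensorProduct.tensorTensorTensorComm K A A P P (y ⊗ₜ (p ⊗ₜ s))) =
        M (y ⊗ₜ ρP s) := by
      induction y using TensorProduct.induction_on with
      | zero => simp
      | add x y hx hy => simp only [TensorProduct.add_tmul, map_add, hx, hy]
      | tmul a b => rfl
    let T : H ⊗[K] P →ₗ[K] (A ⊗[K] P) ⊗[K] (A ⊗[K] P) :=
      (TensorProduct.tensorTensorTensorComm K A A P P).toLinearMap ∘ₗ τ.rTensor (P ⊗[K] P) ∘ₗ
        (TensorProduct.leftComm K P H P).toLinearMap ∘ₗ TensorProduct.mk K P (H ⊗[K] P) p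
    have g1 (z : H ⊗[K] P) : (cotensorLeft P ρA).toLinearMap.lTensor (A ⊗[K] P) (T z) =
        M (τ.rTensor _ (TensorProduct.assoc K H H P
          ((Coalgebra.comul : H →ₗ[K] H ⊗[K] H).rTensor P z))) := by
      induction z using TensorProduct.induction_on with
      | zero => simp
      | add x y hx hy => simp only [map_add, hx, hy]
      | tmul h s =>
        rw [LinearMap.rTensor_tmul, ← f2]
        exact (f1 (τ h) s).trans (congrArg (N s) (LinearMap.congr_fun hτ h))
    have g2 (z : H ⊗[K] P) : (cotensorRight A ρP).toLinearMap.lTensor (A ⊗[K] P) (T z) =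
        M (τ.rTensor _ (ρP.toLinearMap.lTensor H z)) := by
      induction z using TensorProduct.induction_on with
      | zero => simp
      | add x y hx hy => simp only [map_add, hx, hy]
      | tmul h s => exact f3 (τ h) s
    exact (g1 (ρP q)).trans ((congrArg (fun z => M (τ.rTensor _ z))
      (LinearMap.congr_fun hρP.coassoc q).symm).trans (g2 (ρP q)).symm)

-- The first leg needs `p ⊗ q = τP(c)`. By left covariance the left side is `(q₋₁^[1] ⊗ S(q₋₂) ⊗ p)
-- ⊗ (q₋₁^[2] ⊗ q₀)`, and the right side is `(q₋₁^[1] ⊗ p₋₁ ⊗ p₀) ⊗ (q₋₁^[2] ⊗ q₀)`; antipode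
-- covariance, `p₋₁ ⊗ p₀ ⊗ q = S(q₋₁) ⊗ p ⊗ q₀`, identifies them.
set_option maxHeartbeats 600000 in
theorem rTensor_cotensorLift {ρA : A →ₐ[K] A ⊗[K] H} {ρP : P →ₐ[K] H ⊗[K] P}
    (hρP : IsLeftCoaction ρP.toLinearMap) {τA : H →ₗ[K] A ⊗[K] A}
    (hτA : IsLeftCovariant ρA.toLinearMap τA) {τP : C →ₗ[K] P ⊗[K] P}
    (hτP : IsAntipodeCovariant ρP.toLinearMap τP) (c : C) :
    (cotensorLeft P ρA).toLinearMap.rTensor (A ⊗[K] P)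
        (cotensorLift τA ρP.toLinearMap (τP c)) =
      (cotensorRight A ρP).toLinearMap.rTensor (A ⊗[K] P)
        (cotensorLift τA ρP.toLinearMap (τP c)) := by
  -- `B` only regroups factors. On elements, `J(w ⊗ q) = (q₋₁^[1] ⊗ w) ⊗ (q₋₁^[2] ⊗ q₀)`, `L p (h ⊗
  -- k ⊗ s) = (k^[1] ⊗ S(h) ⊗ p) ⊗ (k^[2] ⊗ s)` and `N p q (h ⊗ a ⊗ b) = (a ⊗ h ⊗ p) ⊗ (b ⊗ q)`,
  -- while `T p` is the lift with the coaction on `q` left open.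
  let B : (A ⊗[K] A) ⊗[K] ((H ⊗[K] P) ⊗[K] P) →ₗ[K] (A ⊗[K] (H ⊗[K] P)) ⊗[K] (A ⊗[K] P) :=
    (TensorProduct.tensorTensorTensorComm K A A (H ⊗[K] P) P).toLinearMap
  let J : (H ⊗[K] P) ⊗[K] P →ₗ[K] (A ⊗[K] (H ⊗[K] P)) ⊗[K] (A ⊗[K] P) :=
    B ∘ₗ τA.rTensor _ ∘ₗ (TensorProduct.leftComm K (H ⊗[K] P) H P).toLinearMap ∘ₗ
      ρP.toLinearMap.lTensor (H ⊗[K] P)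
  let L (p : P) : H ⊗[K] (H ⊗[K] P) →ₗ[K] (A ⊗[K] (H ⊗[K] P)) ⊗[K] (A ⊗[K] P) :=
    B ∘ₗ τA.rTensor _ ∘ₗ (TensorProduct.leftComm K (H ⊗[K] P) H P).toLinearMap ∘ₗ
      ((TensorProduct.mk K H P).flip p ∘ₗ HopfAlgebra.antipode K).rTensor (H ⊗[K] P)
  let N (p q : P) : H ⊗[K] (A ⊗[K] A) →ₗ[K] (A ⊗[K] (H ⊗[K] P)) ⊗[K] (A ⊗[K] P) :=
    B ∘ₗ (TensorProduct.comm K ((H ⊗[K] P) ⊗[K] P) (A ⊗[K] A)).toLinearMap ∘ₗ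
      ((TensorProduct.mk K (H ⊗[K] P) P).flip q ∘ₗ
        (TensorProduct.mk K H P).flip p).rTensor (A ⊗[K] A)
  let T (p : P) : H ⊗[K] P →ₗ[K] (A ⊗[K] P) ⊗[K] (A ⊗[K] P) :=
    (TensorProduct.tensorTensorTensorComm K A A P P).toLinearMap ∘ₗ τA.rTensor (P ⊗[K] P) ∘ₗ
      (TensorProduct.leftComm K P H P).toLinearMap ∘ₗ TensorProduct.mk K P (H ⊗[K] P) p
  have hT (p q : P) : cotensorLift τA ρP.toLinearMap (p ⊗ₜ q) = T p (ρP q) := rfl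
  -- the right-hand side
  have r1 (y : A ⊗[K] A) (p s : P) : (cotensorRight A ρP).toLinearMap.rTensor (A ⊗[K] P)
      (TensorProduct.tensorTensorTensorComm K A A P P (y ⊗ₜ (p ⊗ₜ s))) = B (y ⊗ₜ (ρP p ⊗ₜ s)) := by
    induction y using TensorProduct.induction_on with
    | zero => simp only [map_zero, TensorProduct.zero_tmul]
    | add x y hx hy => simp only [TensorProduct.add_tmul, map_add, hx, hy]
    | tmul a b => rfl
  have r2 (x : P ⊗[K] P) : (cotensorRight A ρP).toLinearMap.rTensor (A ⊗[K] P)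
      (cotensorLift τA ρP.toLinearMap x) = J (ρP.toLinearMap.rTensor P x) := by
    induction x using TensorProduct.induction_on with
    | zero => simp only [map_zero]
    | add x y hx hy => simp only [map_add, hx, hy]
    | tmul p q =>
      rw [hT]
      change _ = B (τA.rTensor _ (TensorProduct.leftComm K (H ⊗[K] P) H P (ρP p ⊗ₜ ρP q)))
      generalize ρP q = z
      induction z using TensorProduct.induction_on with
      | zero => simp only [map_zero, TensorProduct.tmul_zero]
      | add x y hx hy => simp only [TensorProduct.tmul_add, map_add, hx, hy]
      | tmul h s => exact r1 (τA h) p s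
  have r3 (p q : P) : J ((TensorProduct.assoc K H P P).symm (TensorProduct.leftComm K P H P
      (((HopfAlgebra.antipode K).rTensor P ∘ₗ ρP.toLinearMap).lTensor P (p ⊗ₜ q)))) =
      L p (ρP.toLinearMap.lTensor H (ρP q)) := by
    simp only [LinearMap.lTensor_tmul, LinearMap.comp_apply, AlgHom.toLinearMap_apply]
    generalize ρP q = z
    induction z using TensorProduct.induction_on with
    | zero => simp only [map_zero, TensorProduct.tmul_zero]
    | add x y hx hy => simp only [TensorProduct.tmul_add, map_add, hx, hy]
    | tmul h s => rfl
  -- the left-hand side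
  have l1 (y : A ⊗[K] A) (p s : P) : (cotensorLeft P ρA).toLinearMap.rTensor (A ⊗[K] P)
      (TensorProduct.tensorTensorTensorComm K A A P P (y ⊗ₜ (p ⊗ₜ s))) =
      N p s (TensorProduct.assoc K H A A
        (((TensorProduct.comm K A H).toLinearMap ∘ₗ ρA.toLinearMap).rTensor A y)) := by
    induction y using TensorProduct.induction_on with
    | zero => simp only [map_zero, TensorProduct.zero_tmul]
    | add x y hx hy => simp only [TensorProduct.add_tmul, map_add, hx, hy]
    | tmul a b =>
      change TensorProduct.assoc K A H P (ρA a ⊗ₜ p) ⊗ₜ (b ⊗ₜ s) =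
        N p s (TensorProduct.assoc K H A A (TensorProduct.comm K A H (ρA a) ⊗ₜ b))
      generalize ρA a = z
      induction z using TensorProduct.induction_on with
      | zero => simp only [map_zero, TensorProduct.zero_tmul]
      | add x y hx hy => simp only [TensorProduct.add_tmul, map_add, hx, hy]
      | tmul h s => rfl
  have l2 (w : H ⊗[K] H) (p s : P) :
      N p s (TensorProduct.map (HopfAlgebra.antipode K) τA w) =
        L p (TensorProduct.assoc K H H P (w ⊗ₜ s)) := by
    induction w using TensorProduct.induction_on with
    | zero => simp only [map_zero, TensorProduct.zero_tmul]
    | add x y hx hy => simp only [TensorProduct.add_tmul, map_add, hx, hy]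
    | tmul h k => rfl
  have l3 (p : P) (z : H ⊗[K] P) : (cotensorLeft P ρA).toLinearMap.rTensor (A ⊗[K] P) (T p z) =
      L p (TensorProduct.assoc K H H P
        ((Coalgebra.comul : H →ₗ[K] H ⊗[K] H).rTensor P z)) := by
    induction z using TensorProduct.induction_on with
    | zero => simp only [map_zero]
    | add x y hx hy => simp only [map_add, hx, hy]
    | tmul h s =>
      rw [LinearMap.rTensor_tmul, ← l2]
      exact (l1 (τA h) p s).trans (congrArg (N p s) (LinearMap.congr_fun hτA h))
  have key (x : P ⊗[K] P) : (cotensorLeft P ρA).toLinearMap.rTensor (A ⊗[K] P)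
      (cotensorLift τA ρP.toLinearMap x) =
      J ((TensorProduct.assoc K H P P).symm (TensorProduct.leftComm K P H P
        (((HopfAlgebra.antipode K).rTensor P ∘ₗ ρP.toLinearMap).lTensor P x))) := by
    refine LinearMap.congr_fun (f := (cotensorLeft P ρA).toLinearMap.rTensor (A ⊗[K] P) ∘ₗ
      cotensorLift τA ρP.toLinearMap) (g := J ∘ₗ (TensorProduct.assoc K H P P).symm.toLinearMap ∘ₗ
        (TensorProduct.leftComm K P H P).toLinearMap ∘ₗ
        ((HopfAlgebra.antipode K).rTensor P ∘ₗ ρP.toLinearMap).lTensor P)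
        (TensorProduct.ext' fun p q => ?_) x
    exact (l3 p (ρP q)).trans ((congrArg (L p) (LinearMap.congr_fun hρP.coassoc q).symm).trans
      (r3 p q).symm)
  have hc := LinearMap.congr_fun hτP c
  simp only [LinearMap.comp_apply, LinearEquiv.coe_coe] at hc
  rw [← LinearEquiv.eq_symm_apply] at hc
  rw [key, r2, hc]

/-- The `A`-components multiply to `q₋₁^[1] q₋₁^[2] = ε(q₋₁)`, after which the counit removes the
coaction on `q` and `1 ⊗ p ρ^C(q)` is left. -/
theorem liftedCan_cotensorLift {ρA : A →ₗ[K] A ⊗[K] H} (hρA : IsRightCoaction ρA)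
    {ρP : P →ₗ[K] H ⊗[K] P} (hρP : IsLeftCoaction ρP) (ρC : P →ₗ[K] P ⊗[K] C)
    {τ : H →ₗ[K] A ⊗[K] A} (hτ : IsColifting ρA τ) (x : P ⊗[K] P) :
    liftedCan ((TensorProduct.assoc K A P C).symm.toLinearMap ∘ₗ ρC.lTensor A)
        (cotensorLift τ ρP x) =
      (TensorProduct.assoc K A P C).symm (1 ⊗ₜ liftedCan ρC x) := by
  induction x using TensorProduct.induction_on with
  | zero => simp
  | add x y hx hy => simp only [TensorProduct.tmul_add, map_add, hx, hy]
  | tmul p q =>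
    have e0 (a b : A) (z : P ⊗[K] C) :
        (a ⊗ₜ[K] p : A ⊗[K] P) • (TensorProduct.assoc K A P C).symm (b ⊗ₜ z) =
          (TensorProduct.assoc K A P C).symm ((a * b) ⊗ₜ (p • z)) := by
      induction z using TensorProduct.induction_on with
      | zero => simp
      | add x y hx hy => simp only [TensorProduct.tmul_add, smul_add, map_add, hx, hy]
      | tmul s c => simp [TensorProduct.smul_tmul']
    have e1 (y : A ⊗[K] A) (s : P) :
        liftedCan ((TensorProduct.assoc K A P C).symm.toLinearMap ∘ₗ ρC.lTensor A)
          (TensorProduct.tensorTensorTensorComm K A A P P (y ⊗ₜ (p ⊗ₜ s))) =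
          (TensorProduct.assoc K A P C).symm (LinearMap.mul' K A y ⊗ₜ (p • ρC s)) := by
      induction y using TensorProduct.induction_on with
      | zero => simp
      | add x y hx hy => simp only [TensorProduct.add_tmul, map_add, hx, hy]
      | tmul a b => simp [liftedCan_tmul, e0]
    have e2 (z : H ⊗[K] P) :
        liftedCan ((TensorProduct.assoc K A P C).symm.toLinearMap ∘ₗ ρC.lTensor A)
          (TensorProduct.tensorTensorTensorComm K A A P P (τ.rTensor (P ⊗[K] P)
            (TensorProduct.leftComm K P H P (p ⊗ₜ z)))) =
          (TensorProduct.assoc K A P C).symm (1 ⊗ₜ (p • ρC (TensorProduct.lid K P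
            ((Coalgebra.counit : H →ₗ[K] K).rTensor P z)))) := by
      induction z using TensorProduct.induction_on with
      | zero => simp
      | add x y hx hy => simp only [TensorProduct.tmul_add, smul_add, map_add, hx, hy]
      | tmul h s =>
        rw [TensorProduct.leftComm_tmul, LinearMap.rTensor_tmul, e1, hτ.mul'_apply hρA,
          Algebra.algebraMap_eq_smul_one, TensorProduct.smul_tmul]
        simp [smul_comm p]
    have hcu := LinearMap.congr_fun hρP.counit q
    simp only [LinearMap.comp_apply, LinearEquiv.coe_coe, LinearMap.id_apply] at hcu
    refine (e2 (ρP q)).trans ?_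
    rw [hcu, liftedCan_tmul]

/-- The colifting of the translation map of `A □_H P`. -/
theorem exists_isColifting_cotensor [Module.Flat K C] [Module.Flat K H] [Module.Flat K A]
    [Module.Flat K P] {ρA : A →ₐ[K] A ⊗[K] H} (hρA : IsRightCoaction ρA.toLinearMap)
    {ρP : P →ₐ[K] H ⊗[K] P} [Module.Flat K (cotensor ρA ρP)]
    (hρP : IsLeftCoaction ρP.toLinearMap) {ρC : P →ₗ[K] P ⊗[K] C}
    (hPC : CoactionsCommute ρP.toLinearMap ρC)
    {τA : H →ₗ[K] A ⊗[K] A} (hτA : IsColifting ρA.toLinearMap τA)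
    (hr : IsRightCovariant ρA.toLinearMap τA) (hl : IsLeftCovariant ρA.toLinearMap τA)
    {τP : C →ₗ[K] P ⊗[K] P} (hτP : IsColifting ρC τP)
    (hcov : IsAntipodeCovariant ρP.toLinearMap τP) :
    ∃ τ : C →ₗ[K] cotensor ρA ρP ⊗[K] cotensor ρA ρP,
      IsColifting (cotensorCoaction ρA ρP ρC hPC) τ := by
  let i := (cotensor ρA ρP).val.toLinearMap
  have hi : Function.Injective i := Subtype.val_injective
  have mem (c : C) : (cotensorLift τA ρP.toLinearMap ∘ₗ τP) c ∈
      LinearMap.range (TensorProduct.map i i) := by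
    apply mem_range_map_of_exact hi (cotensor_exact ρA ρP)
    · rw [LinearMap.rTensor_sub]
      exact sub_eq_zero.mpr (rTensor_cotensorLift hρP hl hcov c)
    · rw [LinearMap.lTensor_sub]
      exact sub_eq_zero.mpr (lTensor_cotensorLift hρP hr (τP c))
  let τ := LinearMap.codRestrictOfInjective _ _ (map_injective_of_flat hi) mem
  have hτ (c : C) : TensorProduct.map i i (τ c) = cotensorLift τA ρP.toLinearMap (τP c) :=
    LinearMap.codRestrictOfInjective_comp_apply _ _ _ _ c
  refine ⟨τ, fun c => cotensor_rTensor_injective ρA ρP ?_⟩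
  have e (x : cotensor ρA ρP ⊗[K] cotensor ρA ρP) :
      i.rTensor C (liftedCan (cotensorCoaction ρA ρP ρC hPC) x) =
      liftedCan ((TensorProduct.assoc K A P C).symm.toLinearMap ∘ₗ ρC.lTensor A)
        (TensorProduct.map i i x) := by
    induction x using TensorProduct.induction_on with
    | zero => simp
    | add x y hx hy => simp only [map_add, hx, hy]
    | tmul p q =>
      have hs (z : cotensor ρA ρP ⊗[K] C) : i.rTensor C (p • z) = i p • i.rTensor C z := by
        induction z using TensorProduct.induction_on with
        | zero => simp
        | add x y hx hy => simp only [smul_add, map_add, hx, hy]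
        | tmul s c => simp [TensorProduct.smul_tmul', i]
      rw [liftedCan_tmul, hs, TensorProduct.map_tmul, liftedCan_tmul]
      exact congrArg (i p • ·) (rTensor_cotensorCoaction ρA ρP ρC hPC q)
  refine (e _).trans ?_
  rw [hτ, liftedCan_cotensorLift hρA hρP ρC hτA, hτP]
  simp [Algebra.TensorProduct.one_def]

end Cotensor

end

end CotensorGalois

theorem mainTheorem3 {K H C A P : Type*} [Field K]
    [Ring H] [HopfAlgebra K H]
    [AddCommGroup C] [Module K C] [Coalgebra K C]
    [Ring A] [Algebra K A] [Ring P] [Algebra K P]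
    -- `C` is coseparable
    (hC : IsCoseparable K C)
    -- `A` is a right `H`-comodule algebra
    (ρA : A →ₐ[K] A ⊗[K] H) (hρA : IsRightCoaction ρA.toLinearMap)
    -- `P` is a left `H`-comodule algebra and an `(H, C)`-bicomodule
    (ρP : P →ₐ[K] H ⊗[K] P) (hρP : IsLeftCoaction ρP.toLinearMap)
    (ρC : P →ₗ[K] P ⊗[K] C) (hρC : IsRightCoaction ρC)
    (hPC : CoactionsCommute ρP.toLinearMap ρC)
    -- `P` is `e`-copointed with a bijective entwining
    (e : C) (he : IsGroupLikeElem K e)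
    (ψ : C ⊗[K] P →ₗ[K] P ⊗[K] C) (hψ : IsEntwining ψ) (hψbij : Function.Bijective ψ)
    (hψe : ∀ p : P, ρC p = ψ (e ⊗ₜ p))
    -- covariant coliftings of the translation maps on `A` and on `P`
    (hτA : ∃ τA : H →ₗ[K] A ⊗[K] A, IsColifting ρA.toLinearMap τA ∧
      IsRightCovariant ρA.toLinearMap τA ∧ IsLeftCovariant ρA.toLinearMap τA)
    (hτP : ∃ τP : C →ₗ[K] P ⊗[K] P, IsColifting ρC τP ∧
      IsAntipodeCovariant ρP.toLinearMap τP) :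
    IsPrincipalExtension (cotensorCoaction ρA ρP ρC hPC) e := by

  obtain ⟨τA, hA, hAr, hAl⟩ := hτA
  obtain ⟨τP, hP, hPcov⟩ := hτP
  have hcol := rTensor_comp_eq_tensorEntwining_comp hρP hPC hψ hψe hP hPcov
  -- The flatness required from here on is automatic over a field.
  obtain ⟨φ, hφ, hφbij, hφe⟩ := exists_entwining_cotensor ρA ρP ρC hPC hψ hψbij hψe hcol
  obtain ⟨τ, hτ⟩ := exists_isColifting_cotensor hρA hρP hPC hA hAr hAl hP hPcov
  exact isPrincipalExtension_of_isColifting hC hφ hφbij he hφe hτ
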